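/- Let $\mathbb D$ be the open unit disk and $\mathbb T$ the unit circle with normalized Lebesgue measure $m$; write $L^p=L^p(\mathbb T,m)$. Let $H^2\subset L^2$ be the Hardy space, i.e. the space of all $f\in L^2$ with $\hat f(n)=0$ for every $n<0$. Let $\Theta$ be a nonconstant inner function, i.e. a nonconstant bounded analytic function on $\mathbb D$ whose radial limits have modulus one almost everywhere on $\mathbb T$. Let $K_\Theta=H^2\ominus\Theta H^2$ be the associated model space and $P_\Theta$ the orthogonal projection of $L^2$ onto $K_\Theta$. For $\lambda\in\mathbb D$ let $$k_\lambda^\Theta(z)=\frac{1-\overline{\Theta(\lambda)}\,\Theta(z)}{1-\overline\lambda z}$$ be the reproducing kernel of $K_\Theta$ at $\lambda$, and let $\|k_\lambda^\Theta\|_p$ be the $L^p$ norm of its boundary function on $\mathbb T$. For $\varphi\in L^2$, the truncated Toeplitz operator $A_\varphi^\Theta$ with symbol $\varphi$ is the (possibly unbounded) operator on $K_\Theta$ with dense domain $K_\Theta\cap H^\infty$ given by $A_\varphi^\Theta f=P_\Theta(\varphi f)$. Let $\mathcal T(K_\Theta)$ be the set of bounded operators $A$ on $K_\Theta$ that are,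 for some $\varphi\in L^2$, the bounded extension of $A_\varphi^\Theta$; every such $\varphi$ is called a symbol of $A$ (it is not unique). **Theorem.** Suppose that each operator in $\mathcal T(K_\Theta)$ has a symbol in $L^\infty$. Then for each real number $p>2$, $$\sup_{\lambda\in\mathbb D}\frac{\|k_\lambda^\Theta\|_p}{\|k_\lambda^\Theta\|_2^2}<\infty .$$ -/

import Mathlib

open MeasureTheory Filter Topology AddCircle
open scoped ENNReal ComplexConjugate

noncomputable section

/-- `L²` of the unit circle. The circle is parametrized by `t ↦ exp (2 π i t)`, `t ∈ ℝ/ℤ`, and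
carries normalized Lebesgue measure `m`. -/
abbrev CircleL2 : Type := Lp ℂ 2 (haarAddCircle : Measure UnitAddCircle)

/-- The boundary function (radial limits) of a function on the unit disk: its value at `t` is
`lim_{r → 1⁻} f (r ζ)`, where `ζ = exp (2 π i t)`. -/
def radialLimit (f : ℂ → ℂ) (t : UnitAddCircle) : ℂ :=
  limUnder (𝓝[<] (1 : ℝ)) fun r : ℝ => f ((r : ℂ) * (toCircle t : ℂ))

/-- `Θ` is an inner function: a bounded analytic function on the open unit disk whose radial
limits have modulus one almost everywhere on the unit circle. Only the values of `Θ` in the open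
disk matter. -/
structure IsInner (Θ : ℂ → ℂ) : Prop where
  differentiableOn : DifferentiableOn ℂ Θ (Metric.ball 0 1)
  bounded : ∃ M : ℝ, ∀ z ∈ Metric.ball (0 : ℂ) 1, ‖Θ z‖ ≤ M
  radial : ∀ᵐ t ∂(haarAddCircle : Measure UnitAddCircle), ∃ w : ℂ, ‖w‖ = 1 ∧
    Tendsto (fun r : ℝ => Θ ((r : ℂ) * (toCircle t : ℂ))) (𝓝[<] (1 : ℝ)) (𝓝 w)

/-- The Hardy space `H²`, as the subspace of the `f ∈ L²` all of whose Fourier coefficients of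
negative index vanish. -/
def hardySpace : Submodule ℂ CircleL2 where
  carrier := {f | ∀ n : ℤ, n < 0 → fourierCoeff f n = 0}
  add_mem' := by
    intro f g hf hg n hn
    have h1 := hf n hn
    have h2 := hg n hn
    rw [← fourierBasis_repr] at h1 h2 ⊢
    simp [h1, h2]
  zero_mem' := by
    intro n _
    rw [← fourierBasis_repr]
    simp
  smul_mem' := by
    intro c f hf n hn
    have h1 := hf n hn
    rw [← fourierBasis_repr] at h1 ⊢
    simp [h1]

/-- The subspace `Θ H² = {Θ g : g ∈ H²}` of `L²`. -/
def innerMulHardy (Θ : ℂ → ℂ) : Submodule ℂ CircleL2 where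
  carrier := {h | ∃ g ∈ hardySpace, ∀ᵐ t ∂(haarAddCircle : Measure UnitAddCircle),
    h t = radialLimit Θ t * g t}
  add_mem' := by
    rintro h₁ h₂ ⟨g₁, hg₁, e₁⟩ ⟨g₂, hg₂, e₂⟩
    refine ⟨g₁ + g₂, add_mem hg₁ hg₂, ?_⟩
    filter_upwards [e₁, e₂, Lp.coeFn_add h₁ h₂, Lp.coeFn_add g₁ g₂] with t a b c d
    rw [c, d, Pi.add_apply, Pi.add_apply, a, b, mul_add]
  zero_mem' := by
    refine ⟨0, zero_mem _, ?_⟩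
    filter_upwards [Lp.coeFn_zero ℂ 2 (haarAddCircle : Measure UnitAddCircle)] with t a
    rw [a, Pi.zero_apply, mul_zero]
  smul_mem' := by
    rintro c h ⟨g, hg, e⟩
    refine ⟨c • g, Submodule.smul_mem _ c hg, ?_⟩
    filter_upwards [e, Lp.coeFn_smul c h, Lp.coeFn_smul c g] with t a b d
    rw [b, d, Pi.smul_apply, Pi.smul_apply, a, smul_eq_mul, smul_eq_mul]
    ring

/-- The model space `K_Θ = H² ⊖ Θ H²`. -/
def modelSpace (Θ : ℂ → ℂ) : Submodule ℂ CircleL2 :=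
  hardySpace ⊓ (innerMulHardy Θ)ᗮ

theorem isClosed_hardySpace : IsClosed (hardySpace : Set CircleL2) := by
  have h : (hardySpace : Set CircleL2) =
      ⋂ n : ℤ, ⋂ _ : n < 0, {f : CircleL2 | fourierBasis.repr f n = 0} := by
    ext f
    simp [hardySpace, fourierBasis_repr]
  rw [h]
  refine isClosed_iInter fun n => isClosed_iInter fun _ => ?_
  have hc : Continuous fun f : CircleL2 => fourierBasis.repr f n := by
    simp only [HilbertBasis.repr_apply_apply]
    fun_prop
  exact isClosed_eq hc continuous_const

theorem isClosed_modelSpace (Θ : ℂ → ℂ) : IsClosed (modelSpace Θ : Set CircleL2) :=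
  isClosed_hardySpace.inter (Submodule.isClosed_orthogonal _)

instance instCompleteSpaceModelSpace (Θ : ℂ → ℂ) : CompleteSpace (modelSpace Θ) :=
  (isClosed_modelSpace Θ).completeSpace_coe

/-- `K_Θ ∩ H^∞`, as a subspace of `K_Θ`. -/
def boundedPart (Θ : ℂ → ℂ) : Submodule ℂ (modelSpace Θ) where
  carrier := {f | MemLp (f : CircleL2) ∞ haarAddCircle}
  add_mem' := by
    intro f g hf hg
    exact (MemLp.add hf hg).ae_eq (Lp.coeFn_add (f : CircleL2) (g : CircleL2)).symm
  zero_mem' := by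
    exact (MemLp.zero (p := ∞)).ae_eq
      (Lp.coeFn_zero ℂ 2 (haarAddCircle : Measure UnitAddCircle)).symm
  smul_mem' := by
    intro c f hf
    exact (MemLp.const_smul hf c).ae_eq (Lp.coeFn_smul c (f : CircleL2)).symm

theorem memLp_symbol_mul {Θ : ℂ → ℂ} (φ : CircleL2) (f : boundedPart Θ) :
    MemLp (fun t => φ t * ((f : modelSpace Θ) : CircleL2) t) 2 haarAddCircle :=
  MemLp.mul (p := 2) (q := ∞) (r := 2) f.2 (Lp.memLp φ)

/-- The truncated Toeplitz operator `A_φ^Θ` with symbol `φ ∈ L²`: the (possibly unbounded) operator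
on `K_Θ` with domain `K_Θ ∩ H^∞` given by `f ↦ P_Θ (φ f)`, where `P_Θ` is the orthogonal
projection of `L²` onto `K_Θ`. -/
def truncatedToeplitz (Θ : ℂ → ℂ) (φ : CircleL2) : modelSpace Θ →ₗ.[ℂ] modelSpace Θ where
  domain := boundedPart Θ
  toFun :=
    { toFun := fun f => (modelSpace Θ).orthogonalProjectionOnto ((memLp_symbol_mul φ f).toLp _)
      map_add' := by
        intro f g
        rw [← map_add, ← MemLp.toLp_add]
        congr 1
        refine MemLp.toLp_congr _ _ ?_
        filter_upwards [Lp.coeFn_add ((f : modelSpace Θ) : CircleL2)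
          ((g : modelSpace Θ) : CircleL2)] with t ht
        simp only [Submodule.coe_add, Pi.add_apply] at ht ⊢
        rw [ht, mul_add]
      map_smul' := by
        intro c f
        rw [RingHom.id_apply, ← map_smul, ← MemLp.toLp_const_smul]
        congr 1
        refine MemLp.toLp_congr _ _ ?_
        filter_upwards [Lp.coeFn_smul c ((f : modelSpace Θ) : CircleL2)] with t ht
        simp only [Submodule.coe_smul, Pi.smul_apply, smul_eq_mul] at ht ⊢
        rw [ht]
        ring }

/-- `φ ∈ L²` is a symbol of the bounded operator `A` on `K_Θ`: `A` is the bounded extension of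
`A_φ^Θ`, that is, `A f = A_φ^Θ f` for every `f ∈ K_Θ ∩ H^∞`. -/
def IsSymbol (Θ : ℂ → ℂ) (φ : CircleL2) (A : modelSpace Θ →L[ℂ] modelSpace Θ) : Prop :=
  ∀ f : (truncatedToeplitz Θ φ).domain, A (f : modelSpace Θ) = truncatedToeplitz Θ φ f

/-- `𝒯(K_Θ)`: the bounded truncated Toeplitz operators on `K_Θ`. -/
def boundedTruncatedToeplitz (Θ : ℂ → ℂ) : Set (modelSpace Θ →L[ℂ] modelSpace Θ) :=
  {A | ∃ φ : CircleL2, IsSymbol Θ φ A}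

/-- `A` has a symbol that belongs to `L^∞`. -/
def HasBoundedSymbol (Θ : ℂ → ℂ) (A : modelSpace Θ →L[ℂ] modelSpace Θ) : Prop :=
  ∃ ψ : CircleL2, MemLp ψ ∞ haarAddCircle ∧ IsSymbol Θ ψ A

/-- The reproducing kernel `k_λ^Θ(z) = (1 - conj Θ(λ) Θ(z)) / (1 - conj λ z)` of `K_Θ`, as a
function on the unit disk. -/
def modelKernel (Θ : ℂ → ℂ) (l : ℂ) (z : ℂ) : ℂ :=
  (1 - conj (Θ l) * Θ z) / (1 - conj l * z)

/-- `‖k_λ^Θ‖_p`, the `L^p` norm over the circle of the boundary function of `k_λ^Θ`. -/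
def modelKernelNorm (Θ : ℂ → ℂ) (p : ℝ≥0∞) (l : ℂ) : ℝ≥0∞ :=
  eLpNorm (radialLimit (modelKernel Θ l)) p haarAddCircle

end

-- Write `k_l` for the reproducing kernel and `k̃_l = (Θ - Θ(l)) / (z - l)` for its conjugate
-- kernel. On the circle `|k̃_l| = |k_l|` almost everywhere, because `|Θ| = 1` there. The rank one
-- operator `A f = f(l) k̃_l` has norm at most `‖k_l‖₂²`, and it is a truncated Toeplitz operator
-- with the explicit symbol `rankOneSymbol`, of `L²` norm at most `2 ‖k_l‖₂`.
--
-- By the open mapping theorem, the hypothesis on symbols becomes quantitative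
-- (`exists_boundedSymbol_norm_le`): `A` has a symbol `ψ` with `‖ψ‖_∞ ≤ C max(‖A‖, ‖φ‖₂)` for any
-- given `L²` symbol `φ`. The theorem is applied to the space of pairs `(A, φ)`, which is visibly
-- closed, so no closedness of the set of operators alone is needed. The extra term `‖φ‖₂` is
-- harmless because `‖k_l‖₂` is bounded below, and thus `‖ψ‖_∞ ≤ C' ‖k_l‖₂²`.
--
-- Now test `A` on the bounded function `k_0`: `k_0(l) k̃_l = P_Θ(ψ k_0)`. Here `|k_0(l)| ≥ 1 -
-- |Θ(0)| > 0` since `Θ` is not constant. Moreover `P_Θ X = P₊X - Θ P₊(conj Θ · X)`, where `P₊` is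
-- the Riesz projection, so M. Riesz's theorem makes `P_Θ` bounded from `L^∞` to `L^p`. Hence
-- `‖k_l‖_p = ‖k̃_l‖_p ≤ C'' ‖k_l‖₂²`. Exponents `p = 2^(k+1)` suffice, as `m` is a probability
-- measure.

local notation "𝕞" => (haarAddCircle : Measure UnitAddCircle)

noncomputable section

/-! ### Hardy functions on the circle and Parseval's identity -/

/-- A function on the circle belongs to the Hardy space `H²`. -/
structure IsHardy (f : UnitAddCircle → ℂ) : Prop where
  memLp : MemLp f 2 𝕞
  coeff : ∀ n : ℤ, n < 0 → fourierCoeff f n = 0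

theorem memLp_conj {f : UnitAddCircle → ℂ} {p : ℝ≥0∞} (hf : MemLp f p 𝕞) :
    MemLp (fun t => conj (f t)) p 𝕞 := hf.star

theorem memLp_of_continuous {f : UnitAddCircle → ℂ} (hf : Continuous f) (p : ℝ≥0∞) :
    MemLp f p 𝕞 := by
  obtain ⟨C, hC⟩ := isCompact_univ.exists_bound_of_continuousOn hf.continuousOn
  exact MemLp.of_bound hf.aestronglyMeasurable C (ae_of_all _ fun t => hC t (Set.mem_univ t))

theorem continuous_fourier (n : ℤ) : Continuous fun t : UnitAddCircle => fourier n t :=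
  (fourier n).continuous

theorem memLp_fourier (n : ℤ) (p : ℝ≥0∞) :
    MemLp (fun t : UnitAddCircle => fourier n t) p 𝕞 :=
  memLp_of_continuous (continuous_fourier n) p

theorem memLp_bdd_mul {f g : UnitAddCircle → ℂ} {p : ℝ≥0∞} (hf : MemLp f ∞ 𝕞)
    (hg : MemLp g p 𝕞) : MemLp (fun t => f t * g t) p 𝕞 :=
  MemLp.mul (p := ∞) (q := p) (r := p) hg hf

theorem integrable_mul_L2 {f g : UnitAddCircle → ℂ} (hf : MemLp f 2 𝕞) (hg : MemLp g 2 𝕞) :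
    Integrable (fun t => f t * g t) 𝕞 :=
  memLp_one_iff_integrable.1 (MemLp.mul (p := 2) (q := 2) (r := 1) hg hf)

theorem inner_toLp {f g : UnitAddCircle → ℂ} (hf : MemLp f 2 𝕞) (hg : MemLp g 2 𝕞) :
    inner ℂ (hf.toLp f) (hg.toLp g) = ∫ t, conj (f t) * g t ∂𝕞 := by
  rw [L2.inner_def]
  refine integral_congr_ae ?_
  filter_upwards [hf.coeFn_toLp, hg.coeFn_toLp] with t h1 h2
  rw [h1, h2, RCLike.inner_apply, mul_comm]

theorem inner_eq_integral (f g : CircleL2) :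
    inner ℂ f g = ∫ t, conj (f t) * g t ∂𝕞 := by
  rw [L2.inner_def]
  refine integral_congr_ae (ae_of_all _ fun t => ?_)
  simp only [RCLike.inner_apply, mul_comm]

/-- Parseval's identity for the Fourier coefficients of two square integrable functions. -/
theorem hasSum_conj_fourierCoeff_mul {f g : UnitAddCircle → ℂ} (hf : MemLp f 2 𝕞)
    (hg : MemLp g 2 𝕞) :
    HasSum (fun n : ℤ => conj (fourierCoeff f n) * fourierCoeff g n)
      (∫ t, conj (f t) * g t ∂𝕞) := by
  have h := fourierBasis.hasSum_inner_mul_inner (hf.toLp f) (hg.toLp g)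
  rw [inner_toLp] at h
  refine h.congr_fun ?_
  intro n
  rw [← inner_conj_symm, ← HilbertBasis.repr_apply_apply, ← HilbertBasis.repr_apply_apply,
    fourierBasis_repr, fourierBasis_repr, fourierCoeff_congr_ae hf.coeFn_toLp,
    fourierCoeff_congr_ae hg.coeFn_toLp]

namespace IsHardy

theorem congr {f g : UnitAddCircle → ℂ} (hf : IsHardy f) (h : f =ᵐ[𝕞] g) : IsHardy g :=
  ⟨hf.memLp.ae_eq h, fun n hn => by rw [← fourierCoeff_congr_ae h]; exact hf.coeff n hn⟩

theorem _root_.mem_hardySpace_iff (f : CircleL2) : f ∈ hardySpace ↔ IsHardy f :=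
  ⟨fun h => ⟨Lp.memLp f, h⟩, fun h => h.coeff⟩

theorem toLp_mem {f : UnitAddCircle → ℂ} (hf : IsHardy f) : hf.memLp.toLp f ∈ hardySpace :=
  (mem_hardySpace_iff _).2 (hf.congr hf.memLp.coeFn_toLp.symm)

theorem add {f g : UnitAddCircle → ℂ} (hf : IsHardy f) (hg : IsHardy g) :
    IsHardy (fun t => f t + g t) := by
  refine ⟨hf.memLp.add hg.memLp, fun n hn => ?_⟩
  have h := fourierCoeff.add (hf.memLp.integrable one_le_two) (hg.memLp.integrable one_le_two)
  have h2 := congrFun h n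
  rw [Pi.add_apply, hf.coeff n hn, hg.coeff n hn, add_zero] at h2
  exact h2

theorem const_mul {f : UnitAddCircle → ℂ} (hf : IsHardy f) (c : ℂ) :
    IsHardy (fun t => c * f t) :=
  ⟨hf.memLp.const_mul c, fun n hn => by rw [fourierCoeff.const_mul, hf.coeff n hn, mul_zero]⟩

theorem sub {f g : UnitAddCircle → ℂ} (hf : IsHardy f) (hg : IsHardy g) :
    IsHardy (fun t => f t - g t) :=
  (hf.add (hg.const_mul (-1))).congr (ae_of_all _ fun t => by simp [sub_eq_add_neg])

theorem fourier_nonneg {n : ℤ} (hn : 0 ≤ n) : IsHardy (fun t => fourier n t) := by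
  refine ⟨memLp_fourier n 2, fun m hm => ?_⟩
  rw [fourierCoeff_fourier]
  exact Pi.single_eq_of_ne (by omega) _

theorem const (c : ℂ) : IsHardy (fun _ => c) :=
  ((fourier_nonneg le_rfl).const_mul c).congr (ae_of_all _ fun t => by
    simp only [fourier_zero, mul_one])

/-- The product of two `H²` functions and a character of positive index has mean zero. -/
theorem integral_fourier_mul_mul {f g : UnitAddCircle → ℂ} (hf : IsHardy f) (hg : IsHardy g)
    {n : ℤ} (hn : 0 < n) : ∫ t, fourier n t * (f t * g t) ∂𝕞 = 0 := by
  have hF : MemLp (fun t => conj (fourier n t * f t)) 2 𝕞 :=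
    memLp_conj (memLp_bdd_mul (memLp_fourier n ∞) hf.memLp)
  have h := hasSum_conj_fourierCoeff_mul hF hg.memLp
  -- Parseval has only zero terms: `g` has frequencies `≥ 0`, while `conj (z ^ n f)` has frequencies
  -- `≤ -n < 0`.
  have h0 : ∀ k : ℤ, conj (fourierCoeff (fun t => conj (fourier n t * f t)) k) *
      fourierCoeff g k = 0 := by
    intro k
    rcases lt_or_ge k 0 with hk | hk
    · rw [hg.coeff k hk, mul_zero]
    · have : conj (fourierCoeff (fun t => conj (fourier n t * f t)) k) =
          fourierCoeff f (-(k + n)) := by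
        rw [fourierCoeff, fourierCoeff, ← integral_conj]
        refine integral_congr_ae (ae_of_all _ fun t => ?_)
        simp only [smul_eq_mul, map_mul, Complex.conj_conj, fourier_neg, neg_neg, fourier_add]
        ring
      rw [this, hf.coeff _ (by omega), zero_mul]
  simp_rw [h0] at h
  have h1 := h.unique hasSum_zero
  rw [← h1]
  refine integral_congr_ae (ae_of_all _ fun t => ?_)
  simp only [map_mul, Complex.conj_conj, mul_assoc]

theorem mul {f g : UnitAddCircle → ℂ} (hf : IsHardy f) (hb : MemLp f ∞ 𝕞) (hg : IsHardy g) :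
    IsHardy (fun t => f t * g t) := by
  refine ⟨memLp_bdd_mul hb hg.memLp, fun n hn => ?_⟩
  exact hf.integral_fourier_mul_mul hg (n := -n) (by omega)

theorem integral_fourier_one_mul {f : UnitAddCircle → ℂ} (hf : IsHardy f) :
    ∫ t, fourier 1 t * f t ∂𝕞 = 0 := by
  simpa only [mul_one] using hf.integral_fourier_mul_mul (const 1) one_pos

end IsHardy

/-! ### The Szegő kernel and division by `z - l` -/

/-- The Szegő kernel `1 / (1 - conj l z)` on the circle. -/
def szego (l : ℂ) (t : UnitAddCircle) : ℂ := (1 - conj l * fourier 1 t)⁻¹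

theorem norm_fourier_apply (n : ℤ) (t : UnitAddCircle) : ‖fourier n t‖ = 1 := by
  rw [fourier_apply, Circle.norm_coe]

theorem fourier_mul_conj (n : ℤ) (t : UnitAddCircle) : fourier n t * conj (fourier n t) = 1 := by
  rw [Complex.mul_conj, Complex.normSq_eq_norm_sq, norm_fourier_apply]; simp

theorem szego_denom_ne {l z : ℂ} (hl : ‖l‖ < 1) (hz : ‖z‖ ≤ 1) : 1 - conj l * z ≠ 0 := by
  intro h
  have h1 : ‖conj l * z‖ = 1 := by rw [← sub_eq_zero.1 h, norm_one]
  rw [norm_mul, RCLike.norm_conj] at h1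
  nlinarith [norm_nonneg l, norm_nonneg z]

theorem szego_mul {l : ℂ} (hl : ‖l‖ < 1) (t : UnitAddCircle) :
    szego l t * (1 - conj l * fourier 1 t) = 1 :=
  inv_mul_cancel₀ (szego_denom_ne hl (norm_fourier_apply 1 t).le)

theorem continuous_szego {l : ℂ} (hl : ‖l‖ < 1) : Continuous (szego l) :=
  Continuous.inv₀ (continuous_const.sub (continuous_const.mul (continuous_fourier 1)))
    fun t => szego_denom_ne hl (norm_fourier_apply 1 t).le

theorem memLp_szego {l : ℂ} (hl : ‖l‖ < 1) (p : ℝ≥0∞) : MemLp (szego l) p 𝕞 :=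
  memLp_of_continuous (continuous_szego hl) p

/-- The geometric series of `z / (z - l)` in recursive form; it drives the induction in
`IsHardy.div_sub`. -/
theorem conj_szego {l : ℂ} (hl : ‖l‖ < 1) (t : UnitAddCircle) :
    conj (szego l t) = 1 + l * (conj (fourier 1 t) * conj (szego l t)) := by
  have h := congrArg conj (szego_mul hl t)
  simp only [map_mul, map_sub, map_one, Complex.conj_conj] at h
  linear_combination h

/-- Division of `f ∈ H²` by `z - l` when `f` vanishes at `l`: on the circle,
`1 / (z - l) = conj z * conj (szego l z)`. -/
theorem IsHardy.div_sub {f : UnitAddCircle → ℂ} (hf : IsHardy f) {l : ℂ} (hl : ‖l‖ < 1)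
    (h0 : ∫ t, conj (szego l t) * f t ∂𝕞 = 0) :
    IsHardy (fun t => conj (fourier 1 t) * conj (szego l t) * f t) := by
  have hs : ∀ n : ℤ, MemLp (fun t => fourier n t * (conj (szego l t) * f t)) 2 𝕞 := fun n =>
    memLp_bdd_mul (memLp_fourier n ∞) (memLp_bdd_mul (memLp_conj (memLp_szego hl ∞)) hf.memLp)
  -- Up to a shift by one, these are the negative Fourier coefficients of `f / (z - l)`. Going from
  -- `m` to `m + 1` adds a negative coefficient of `f`, which is zero, and multiplies the previous
  -- integral by `l`; the base case is the vanishing of `f` at `l`.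
  have ha : ∀ m : ℕ, ∫ t, fourier (m : ℤ) t * (conj (szego l t) * f t) ∂𝕞 = 0 := by
    intro m
    induction m with
    | zero => simpa only [Nat.cast_zero, fourier_zero, one_mul] using h0
    | succ m ih =>
      have hc : ∫ t, fourier ((m : ℤ) + 1) t * f t ∂𝕞 = 0 := by
        have := hf.coeff (-((m : ℤ) + 1)) (by omega)
        simpa only [fourierCoeff, neg_neg, smul_eq_mul] using this
      have e : ∀ t, fourier ((m + 1 : ℕ) : ℤ) t * (conj (szego l t) * f t) =
          fourier ((m : ℤ) + 1) t * f t + l * (fourier (m : ℤ) t * (conj (szego l t) * f t)) := by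
        intro t
        have h2 : (fourier ((m : ℤ) + 1) t : ℂ) = fourier (m : ℤ) t * fourier 1 t := fourier_add
        rw [Nat.cast_succ, h2]
        linear_combination (fourier (m : ℤ) t * fourier 1 t * f t) * conj_szego hl t +
          l * fourier (m : ℤ) t * conj (szego l t) * f t * fourier_mul_conj 1 t
      simp_rw [e]
      rw [integral_add, integral_const_mul, ih, hc, mul_zero, add_zero]
      · exact (memLp_bdd_mul (memLp_fourier _ ∞) hf.memLp).integrable one_le_two
      · exact ((hs m).integrable one_le_two).const_mul l
  refine ⟨?_, fun n hn => ?_⟩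
  · exact memLp_bdd_mul (memLp_bdd_mul (memLp_conj (memLp_fourier 1 ∞))
      (memLp_conj (memLp_szego hl ∞))) hf.memLp
  · obtain ⟨m, hm⟩ : ∃ m : ℕ, -n = (m : ℤ) + 1 := ⟨(-n - 1).toNat, by omega⟩
    rw [fourierCoeff, ← ha m, hm]
    refine integral_congr_ae (ae_of_all _ fun t => ?_)
    have h2 : (fourier ((m : ℤ) + 1) t : ℂ) = fourier (m : ℤ) t * fourier 1 t := fourier_add
    simp only [smul_eq_mul]
    rw [h2]
    linear_combination fourier (m : ℤ) t * conj (szego l t) * f t * fourier_mul_conj 1 t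

/-! ### Boundary values of bounded analytic functions -/

theorem fourier_one_unitAddCircle (t : UnitAddCircle) : (fourier 1 t : ℂ) = toCircle t :=
  fourier_one

theorem fourier_natCast_eq_pow (n : ℕ) (t : UnitAddCircle) :
    (fourier (n : ℤ) t : ℂ) = (toCircle t : ℂ) ^ n := by
  rw [fourier_apply, natCast_zsmul, toCircle_nsmul, Circle.coe_pow]

/-- The integral over the unit circle as an average over a circle in the plane. -/
theorem integral_comp_toCircle (F : ℂ → ℂ) :
    ∫ t : UnitAddCircle, F (toCircle t) ∂haarAddCircle = Real.circleAverage F 0 1 := by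
  rw [integral_haarAddCircle, inv_one, one_smul,
    ← UnitAddCircle.intervalIntegral_preimage 0, Real.circleAverage]
  have h := intervalIntegral.integral_comp_mul_left (a := 0) (b := 1)
    (fun x => F (circleMap 0 1 x)) (c := 2 * Real.pi) (by positivity)
  rw [mul_zero, mul_one] at h
  rw [← h, zero_add]
  refine intervalIntegral.integral_congr fun x _ => ?_
  simp only [toCircle_apply_mk, circleMap, Circle.coe_exp, Complex.ofReal_one, one_mul, zero_add,
    div_one]

/-- `γ` is the boundary function of the bounded analytic function `g`. -/
structure IsBoundaryValue (g : ℂ → ℂ) (γ : UnitAddCircle → ℂ) : Prop where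
  differentiableOn : DifferentiableOn ℂ g (Metric.ball 0 1)
  bounded : ∃ M : ℝ, ∀ z ∈ Metric.ball (0 : ℂ) 1, ‖g z‖ ≤ M
  tendsto : ∀ᵐ t ∂𝕞, Tendsto (fun r : ℝ => g ((r : ℂ) * (toCircle t : ℂ))) (𝓝[<] (1 : ℝ)) (𝓝 (γ t))

theorem mul_toCircle_mem_ball {r : ℝ} (h0 : 0 < r) (h1 : r < 1) (t : UnitAddCircle) :
    (r : ℂ) * (toCircle t : ℂ) ∈ Metric.ball (0 : ℂ) 1 := by
  rw [mem_ball_zero_iff, norm_mul, Circle.norm_coe, mul_one, Complex.norm_real,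
    Real.norm_of_nonneg h0.le]
  exact h1

theorem eventually_Ioo_nhdsLT_one : ∀ᶠ r : ℝ in 𝓝[<] (1 : ℝ), 0 < r ∧ r < 1 :=
  Ioo_mem_nhdsLT zero_lt_one

/-- This is the kernel of Cauchy's formula for circle averages. -/
theorem conj_szego_eq_div {l : ℂ} (hl : ‖l‖ < 1) (t : UnitAddCircle) :
    conj (szego l t) = (toCircle t : ℂ) / ((toCircle t : ℂ) - l) := by
  have hne : (toCircle t : ℂ) - l ≠ 0 := by
    intro h
    rw [← sub_eq_zero.1 h, Circle.norm_coe] at hl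
    exact lt_irrefl _ hl
  rw [eq_div_iff hne]
  have h := conj_szego hl t
  have h2 := fourier_mul_conj 1 t
  rw [fourier_one_unitAddCircle] at h h2
  linear_combination (toCircle t : ℂ) * h + l * conj (szego l t) * h2

namespace IsBoundaryValue

variable {g : ℂ → ℂ} {γ : UnitAddCircle → ℂ}

theorem diffContOnCl_dilation (h : DifferentiableOn ℂ g (Metric.ball 0 1)) {r : ℝ} (h0 : 0 < r)
    (h1 : r < 1) : DiffContOnCl ℂ (fun z => g ((r : ℂ) * z)) (Metric.ball 0 |1|) := by
  refine DifferentiableOn.diffContOnCl ?_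
  refine h.comp (by fun_prop) fun z hz => ?_
  have hz2 := Metric.closure_ball_subset_closedBall hz
  rw [abs_one, mem_closedBall_zero_iff] at hz2
  rw [mem_ball_zero_iff, norm_mul, Complex.norm_real, Real.norm_of_nonneg h0.le]
  nlinarith [norm_nonneg z]

theorem integral_fourier_mul_dilation (h : DifferentiableOn ℂ g (Metric.ball 0 1)) {r : ℝ}
    (h0 : 0 < r) (h1 : r < 1) (n : ℕ) :
    ∫ t, fourier ((n : ℤ) + 1) t * g ((r : ℂ) * (toCircle t : ℂ)) ∂𝕞 = 0 := by
  have hd : DiffContOnCl ℂ (fun z => z ^ (n + 1) * g ((r : ℂ) * z)) (Metric.ball 0 |1|) :=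
    (Differentiable.diffContOnCl (f := fun z : ℂ => z ^ (n + 1)) (by fun_prop)).smul (diffContOnCl_dilation h h0 h1)
  have e := hd.circleAverage
  rw [← integral_comp_toCircle] at e
  simp only [ne_eq, Nat.add_eq_zero_iff, one_ne_zero, and_false, not_false_eq_true, zero_pow,
    zero_mul] at e
  rw [← e]
  refine integral_congr_ae (ae_of_all _ fun t => ?_)
  have := fourier_natCast_eq_pow (n + 1) t
  push_cast at this
  simp only [this]

theorem integral_szego_mul_dilation (h : DifferentiableOn ℂ g (Metric.ball 0 1)) {r : ℝ}
    (h0 : 0 < r) (h1 : r < 1) {l : ℂ} (hl : ‖l‖ < 1) :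
    ∫ t, conj (szego l t) * g ((r : ℂ) * (toCircle t : ℂ)) ∂𝕞 = g (r * l) := by
  have e := (diffContOnCl_dilation h h0 h1).circleAverage_smul_div (w := l)
    (by rwa [abs_one, mem_ball_zero_iff])
  rw [← integral_comp_toCircle] at e
  rw [← e]
  refine integral_congr_ae (ae_of_all _ fun t => ?_)
  simp only [conj_szego_eq_div hl, sub_zero, smul_eq_mul]

theorem continuous_dilation (h : DifferentiableOn ℂ g (Metric.ball 0 1)) {r : ℝ}
    (h0 : 0 < r) (h1 : r < 1) :
    Continuous (fun t : UnitAddCircle => g ((r : ℂ) * (toCircle t : ℂ))) :=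
  h.continuousOn.comp_continuous
    (continuous_const.mul (continuous_induced_dom.comp continuous_toCircle))
    fun t => mul_toCircle_mem_ball h0 h1 t

theorem aestronglyMeasurable (h : IsBoundaryValue g γ) : AEStronglyMeasurable γ 𝕞 := by
  obtain ⟨u, hu⟩ := exists_seq_tendsto (𝓝[<] (1 : ℝ))
  obtain ⟨N, hN⟩ := eventually_atTop.1 (hu.eventually eventually_Ioo_nhdsLT_one)
  refine aestronglyMeasurable_of_tendsto_ae atTop
    (f := fun n t => g ((u (n + N) : ℂ) * (toCircle t : ℂ))) (fun n => ?_) ?_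
  · obtain ⟨h0, h1⟩ := hN (n + N) (by omega)
    exact (continuous_dilation h.differentiableOn h0 h1).aestronglyMeasurable
  · filter_upwards [h.tendsto] with t ht
    exact ht.comp (hu.comp (tendsto_add_atTop_nat N))

theorem memLp_top (h : IsBoundaryValue g γ) : MemLp γ ∞ 𝕞 := by
  obtain ⟨M, hM⟩ := h.bounded
  refine memLp_top_of_bound h.aestronglyMeasurable M ?_
  filter_upwards [h.tendsto] with t ht
  refine le_of_tendsto ht.norm ?_
  filter_upwards [eventually_Ioo_nhdsLT_one] with r hr
  exact hM _ (mul_toCircle_mem_ball hr.1 hr.2 t)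

/-- Dominated convergence, by the uniform bound on `g`. It carries identities for the dilations `g(r
z)`, which are analytic across the circle, to the boundary function. -/
theorem tendsto_integral (h : IsBoundaryValue g γ) {G : UnitAddCircle → ℂ} (hG : Continuous G) :
    Tendsto (fun r : ℝ => ∫ t, G t * g ((r : ℂ) * (toCircle t : ℂ)) ∂𝕞) (𝓝[<] (1 : ℝ))
      (𝓝 (∫ t, G t * γ t ∂𝕞)) := by
  obtain ⟨M, hM⟩ := h.bounded
  refine tendsto_integral_filter_of_dominated_convergence (fun t => ‖G t‖ * M) ?_ ?_ ?_ ?_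
  · filter_upwards [eventually_Ioo_nhdsLT_one] with r hr
    exact (hG.mul
      (continuous_dilation h.differentiableOn hr.1 hr.2)).aestronglyMeasurable
  · filter_upwards [eventually_Ioo_nhdsLT_one] with r hr
    refine ae_of_all _ fun t => ?_
    rw [norm_mul]
    exact mul_le_mul_of_nonneg_left (hM _ (mul_toCircle_mem_ball hr.1 hr.2 t)) (norm_nonneg _)
  · exact (((memLp_of_continuous hG 1).integrable le_rfl).norm).mul_const M
  · filter_upwards [h.tendsto] with t ht
    exact ht.const_mul _

theorem isHardy (h : IsBoundaryValue g γ) : IsHardy γ := by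
  refine ⟨h.memLp_top.mono_exponent le_top, fun n hn => ?_⟩
  obtain ⟨m, hm⟩ : ∃ m : ℕ, -n = (m : ℤ) + 1 := ⟨(-n - 1).toNat, by omega⟩
  rw [fourierCoeff, hm]
  refine tendsto_nhds_unique (h.tendsto_integral (continuous_fourier _)) ?_
  refine tendsto_const_nhds.congr' ?_
  filter_upwards [eventually_Ioo_nhdsLT_one] with r hr
  exact (integral_fourier_mul_dilation h.differentiableOn hr.1 hr.2 m).symm

/-- Cauchy's formula: the Szegő kernel reproduces a bounded analytic function from its boundary
values. -/
theorem integral_szego_mul (h : IsBoundaryValue g γ) {l : ℂ} (hl : ‖l‖ < 1) :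
    ∫ t, conj (szego l t) * γ t ∂𝕞 = g l := by
  have hc : Continuous fun t : UnitAddCircle => conj (szego l t) :=
    Complex.continuous_conj.comp (continuous_szego hl)
  refine tendsto_nhds_unique (h.tendsto_integral hc) ?_
  have hg : ContinuousAt g l := (h.differentiableOn.differentiableAt
    (Metric.isOpen_ball.mem_nhds (mem_ball_zero_iff.2 hl))).continuousAt
  have h2 : Tendsto (fun r : ℝ => g (r * l)) (𝓝[<] (1 : ℝ)) (𝓝 (g l)) := by
    refine hg.tendsto.comp ?_
    have : Continuous fun r : ℝ => (r : ℂ) * l := by fun_prop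
    have h3 := this.tendsto 1
    rw [Complex.ofReal_one, one_mul] at h3
    exact h3.mono_left nhdsWithin_le_nhds
  refine h2.congr' ?_
  filter_upwards [eventually_Ioo_nhdsLT_one] with r hr
  exact (integral_szego_mul_dilation h.differentiableOn hr.1 hr.2 hl).symm

theorem mul (h : IsBoundaryValue g γ) {g' : ℂ → ℂ} {γ' : UnitAddCircle → ℂ}
    (h' : IsBoundaryValue g' γ') :
    IsBoundaryValue (fun z => g z * g' z) (fun t => γ t * γ' t) := by
  refine ⟨h.differentiableOn.mul h'.differentiableOn, ?_, ?_⟩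
  · obtain ⟨M, hM⟩ := h.bounded
    obtain ⟨M', hM'⟩ := h'.bounded
    refine ⟨M * M', fun z hz => ?_⟩
    rw [norm_mul]
    exact mul_le_mul (hM z hz) (hM' z hz) (norm_nonneg _) ((norm_nonneg _).trans (hM z hz))
  · filter_upwards [h.tendsto, h'.tendsto] with t h1 h2
    exact h1.mul h2

end IsBoundaryValue

theorem tendsto_mul_toCircle (t : UnitAddCircle) :
    Tendsto (fun r : ℝ => (r : ℂ) * (toCircle t : ℂ)) (𝓝[<] (1 : ℝ)) (𝓝 (toCircle t : ℂ)) := by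
  have : Continuous fun r : ℝ => (r : ℂ) * (toCircle t : ℂ) := by fun_prop
  have h3 := this.tendsto 1
  rw [Complex.ofReal_one, one_mul] at h3
  exact h3.mono_left nhdsWithin_le_nhds

theorem tendsto_szego_radial {l : ℂ} (hl : ‖l‖ < 1) (t : UnitAddCircle) :
    Tendsto (fun r : ℝ => (1 - conj l * ((r : ℂ) * (toCircle t : ℂ)))⁻¹) (𝓝[<] (1 : ℝ))
      (𝓝 (szego l t)) := by
  rw [szego, fourier_one_unitAddCircle]
  exact (tendsto_const_nhds.sub ((tendsto_mul_toCircle t).const_mul _)).inv₀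
    (szego_denom_ne hl (Circle.norm_coe _).le)

theorem isBoundaryValue_szego {l : ℂ} (hl : ‖l‖ < 1) :
    IsBoundaryValue (fun z => (1 - conj l * z)⁻¹) (szego l) := by
  have hz1 : ∀ z ∈ Metric.ball (0 : ℂ) 1, ‖z‖ ≤ 1 := fun z hz => (mem_ball_zero_iff.1 hz).le
  refine ⟨?_, ⟨(1 - ‖l‖)⁻¹, fun z hz => ?_⟩, ae_of_all _ fun t => tendsto_szego_radial hl t⟩
  · exact DifferentiableOn.inv (by fun_prop) fun z hz => szego_denom_ne hl (hz1 z hz)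
  · rw [norm_inv]
    refine inv_anti₀ (by linarith) ?_
    have h1 := norm_sub_norm_le (1 : ℂ) (conj l * z)
    rw [norm_one, norm_mul, RCLike.norm_conj] at h1
    nlinarith [hz1 z hz, norm_nonneg l]

/-! ### Inner functions inside the disk -/

namespace IsInner

variable {Θ : ℂ → ℂ}

theorem ae_radialLimit (hΘ : IsInner Θ) : ∀ᵐ t ∂𝕞, ‖radialLimit Θ t‖ = 1 ∧
    Tendsto (fun r : ℝ => Θ ((r : ℂ) * (toCircle t : ℂ))) (𝓝[<] (1 : ℝ))
      (𝓝 (radialLimit Θ t)) := by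
  filter_upwards [hΘ.radial] with t ht
  obtain ⟨w, hw, h⟩ := ht
  rw [radialLimit, h.limUnder_eq]
  exact ⟨hw, h⟩

theorem isBoundaryValue (hΘ : IsInner Θ) : IsBoundaryValue Θ (radialLimit Θ) :=
  ⟨hΘ.differentiableOn, hΘ.bounded, hΘ.ae_radialLimit.mono fun _ h => h.2⟩

/-- The definition gives only some bound `M`. Applying Cauchy's formula to `Θ s_l`, with `s_l` the
Szegő kernel, gives `Θ(l) s_l(l) = ∫ Θ |s_l|²`, whose modulus is at most `∫ |s_l|² = s_l(l)`: this
is the Poisson integral of `Θ`. -/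
theorem norm_le_one (hΘ : IsInner Θ) {l : ℂ} (hl : ‖l‖ < 1) : ‖Θ l‖ ≤ 1 := by
  have h1 := (hΘ.isBoundaryValue.mul (isBoundaryValue_szego hl)).integral_szego_mul hl
  have h2 := (isBoundaryValue_szego hl).integral_szego_mul hl
  have hn : ∫ t, conj (szego l t) * szego l t ∂𝕞 = ((∫ t, ‖szego l t‖ ^ 2 ∂𝕞 : ℝ) : ℂ) := by
    rw [← integral_complex_ofReal]
    refine integral_congr_ae (ae_of_all _ fun t => ?_)
    simp only [Complex.conj_mul', Complex.ofReal_pow]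
  rw [hn] at h2
  have h3 : ‖∫ t, conj (szego l t) * (radialLimit Θ t * szego l t) ∂𝕞‖ ≤
      ∫ t, ‖szego l t‖ ^ 2 ∂𝕞 := by
    refine (norm_integral_le_integral_norm _).trans_eq (integral_congr_ae ?_)
    filter_upwards [hΘ.ae_radialLimit] with t ht
    rw [norm_mul, norm_mul, ht.1, RCLike.norm_conj, one_mul, sq]
  rw [h1, ← h2, norm_mul, Complex.norm_real,
    Real.norm_of_nonneg (integral_nonneg fun t => sq_nonneg _)] at h3
  have hpos : 0 < ∫ t, ‖szego l t‖ ^ 2 ∂𝕞 := by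
    refine lt_of_le_of_ne (integral_nonneg fun t => sq_nonneg _) fun h0 => ?_
    rw [← h0, Complex.ofReal_zero] at h2
    exact inv_ne_zero (szego_denom_ne hl hl.le) h2.symm
  exact le_of_mul_le_mul_right (by rwa [one_mul]) hpos

/-- Maximum modulus principle. This is where nonconstancy enters. -/
theorem norm_zero_lt_one (hΘ : IsInner Θ)
    (hconst : ¬ ∃ c : ℂ, ∀ z ∈ Metric.ball (0 : ℂ) 1, Θ z = c) : ‖Θ 0‖ < 1 := by
  refine lt_of_le_of_ne (hΘ.norm_le_one (by simp)) fun h => hconst ⟨Θ 0, ?_⟩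
  refine Complex.eqOn_of_isPreconnected_of_isMaxOn_norm (convex_ball 0 1).isPreconnected
    Metric.isOpen_ball hΘ.differentiableOn (Metric.mem_ball_self one_pos) fun z hz => ?_
  simp only [Function.comp_apply, Set.mem_ofPred_eq, h]
  exact hΘ.norm_le_one (mem_ball_zero_iff.1 hz)

theorem radialLimit_modelKernel (hΘ : IsInner Θ) {l : ℂ} (hl : ‖l‖ < 1) :
    radialLimit (modelKernel Θ l) =ᵐ[𝕞]
      fun t => szego l t * (1 - conj (Θ l) * radialLimit Θ t) := by
  filter_upwards [hΘ.ae_radialLimit] with t ht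
  refine Tendsto.limUnder_eq ?_
  have h := (tendsto_szego_radial hl t).mul
    ((tendsto_const_nhds (x := (1 : ℂ))).sub (ht.2.const_mul (conj (Θ l))))
  refine h.congr fun r => ?_
  rw [modelKernel, div_eq_inv_mul]

end IsInner

/-! ### M. Riesz's theorem for exponents that are powers of two -/

instance instCompleteSpaceHardySpace : CompleteSpace hardySpace :=
  isClosed_hardySpace.completeSpace_coe

/-- The Riesz projection, as the orthogonal projection of `L²` onto `H²`. -/
def rieszProjection : CircleL2 →L[ℂ] CircleL2 := hardySpace.starProjection

/-- Analytic trigonometric polynomials. -/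
def analyticPoly : Submodule ℂ C(UnitAddCircle, ℂ) :=
  Submodule.span ℂ (Set.range fun n : ℕ => fourier (n : ℤ))

/-- Antianalytic trigonometric polynomials with mean zero. -/
def antianalyticPoly : Submodule ℂ C(UnitAddCircle, ℂ) :=
  Submodule.span ℂ (Set.range fun n : ℕ => fourier (-((n : ℤ) + 1)))

theorem fourier_mul_fourier (a b : ℤ) :
    (fourier a : C(UnitAddCircle, ℂ)) * fourier b = fourier (a + b) := by
  ext t
  rw [ContinuousMap.mul_apply, fourier_add]

theorem mul_mem_analyticPoly {u v : C(UnitAddCircle, ℂ)} (hu : u ∈ analyticPoly)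
    (hv : v ∈ analyticPoly) : u * v ∈ analyticPoly := by
  have h : analyticPoly * analyticPoly ≤ analyticPoly := by
    rw [analyticPoly, Submodule.span_mul_span, Submodule.span_le]
    rintro _ ⟨_, ⟨a, rfl⟩, _, ⟨b, rfl⟩, rfl⟩
    refine Submodule.subset_span ⟨a + b, ?_⟩
    simp only [fourier_mul_fourier, Nat.cast_add]
  exact h (Submodule.mul_mem_mul hu hv)

theorem mul_mem_antianalyticPoly {u v : C(UnitAddCircle, ℂ)} (hu : u ∈ antianalyticPoly)
    (hv : v ∈ antianalyticPoly) : u * v ∈ antianalyticPoly := by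
  have h : antianalyticPoly * antianalyticPoly ≤ antianalyticPoly := by
    rw [antianalyticPoly, Submodule.span_mul_span, Submodule.span_le]
    rintro _ ⟨_, ⟨a, rfl⟩, _, ⟨b, rfl⟩, rfl⟩
    refine Submodule.subset_span ⟨a + b + 1, ?_⟩
    simp only [fourier_mul_fourier]
    congr 1
  exact h (Submodule.mul_mem_mul hu hv)

theorem exists_add_of_mem_span_fourier {w : C(UnitAddCircle, ℂ)}
    (hw : w ∈ Submodule.span ℂ (Set.range (@fourier (1 : ℝ)))) :
    ∃ u ∈ analyticPoly, ∃ v ∈ antianalyticPoly, u + v = w := by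
  rw [← Submodule.mem_sup]
  refine (Submodule.span_le.2 ?_ : Submodule.span ℂ (Set.range (@fourier (1 : ℝ))) ≤ _) hw
  rintro _ ⟨n, rfl⟩
  rcases lt_or_ge n 0 with hn | hn
  · refine Submodule.mem_sup_right (Submodule.subset_span ⟨(-n - 1).toNat, ?_⟩)
    simp only
    congr 1
    omega
  · refine Submodule.mem_sup_left (Submodule.subset_span ⟨n.toNat, ?_⟩)
    simp only
    congr 1
    omega

theorem toLp_mem_hardySpace_of_analyticPoly {u : C(UnitAddCircle, ℂ)} (hu : u ∈ analyticPoly) :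
    ContinuousMap.toLp (E := ℂ) 2 𝕞 ℂ u ∈ hardySpace := by
  have h : analyticPoly ≤ hardySpace.comap
      (ContinuousMap.toLp (E := ℂ) 2 𝕞 ℂ : C(UnitAddCircle, ℂ) →ₗ[ℂ] CircleL2) := by
    rw [analyticPoly, Submodule.span_le]
    rintro _ ⟨n, rfl⟩
    exact (mem_hardySpace_iff _).2 ((IsHardy.fourier_nonneg (by omega)).congr
      (ContinuousMap.coeFn_toLp 𝕞 (fourier (n : ℤ))).symm)
  exact h hu

theorem toLp_mem_hardySpace_orthogonal {v : C(UnitAddCircle, ℂ)} (hv : v ∈ antianalyticPoly) :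
    ContinuousMap.toLp (E := ℂ) 2 𝕞 ℂ v ∈ hardySpaceᗮ := by
  have h : antianalyticPoly ≤ hardySpaceᗮ.comap
      (ContinuousMap.toLp (E := ℂ) 2 𝕞 ℂ : C(UnitAddCircle, ℂ) →ₗ[ℂ] CircleL2) := by
    rw [antianalyticPoly, Submodule.span_le]
    rintro _ ⟨n, rfl⟩
    refine (Submodule.mem_orthogonal' _ _).2 fun f hf => ?_
    have h1 : fourierCoeff f (-((n : ℤ) + 1)) = 0 := hf _ (by omega)
    rw [← fourierBasis_repr, HilbertBasis.repr_apply_apply, coe_fourierBasis] at h1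
    exact h1
  exact h hv

theorem rieszProjection_toLp {u v : C(UnitAddCircle, ℂ)} (hu : u ∈ analyticPoly)
    (hv : v ∈ antianalyticPoly) :
    rieszProjection (ContinuousMap.toLp (E := ℂ) 2 𝕞 ℂ (u + v)) =
      ContinuousMap.toLp (E := ℂ) 2 𝕞 ℂ u := by
  rw [map_add, map_add, rieszProjection,
    Submodule.starProjection_eq_self_iff.2 (toLp_mem_hardySpace_of_analyticPoly hu),
    (Submodule.starProjection_apply_eq_zero_iff _).2 (toLp_mem_hardySpace_orthogonal hv), add_zero]

theorem norm_toLp_continuous (u : C(UnitAddCircle, ℂ)) (p : ℝ≥0∞) [Fact (1 ≤ p)] :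
    ‖ContinuousMap.toLp (E := ℂ) p 𝕞 ℂ u‖ = (eLpNorm u p 𝕞).toReal := by
  rw [Lp.norm_def, eLpNorm_congr_ae (ContinuousMap.coeFn_toLp 𝕞 u)]

theorem eLpNorm_sq_continuous (u : C(UnitAddCircle, ℂ)) (p : ℝ≥0∞) :
    (eLpNorm (u * u : C(UnitAddCircle, ℂ)) p 𝕞).toReal = (eLpNorm u (p * 2) 𝕞).toReal ^ 2 := by
  have h := eLpNorm_norm_rpow (p := p) (μ := 𝕞) (q := 2) u two_pos
  rw [ENNReal.ofReal_ofNat] at h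
  rw [← Real.rpow_natCast, ENNReal.toReal_rpow, Nat.cast_ofNat, ← h, ← eLpNorm_norm]
  congr 2
  ext t
  simp only [ContinuousMap.coe_mul, Pi.mul_apply, norm_mul, Real.rpow_ofNat, sq]

theorem eLpNorm_mul_le_continuous (u v : C(UnitAddCircle, ℂ)) (p : ℝ≥0∞) :
    (eLpNorm (u * v : C(UnitAddCircle, ℂ)) p 𝕞).toReal ≤
      (eLpNorm u (p * 2) 𝕞).toReal * (eLpNorm v (p * 2) 𝕞).toReal := by
  have : ENNReal.HolderTriple (p * 2) (p * 2) p := ⟨by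
    rw [ENNReal.mul_inv (Or.inr (by simp)) (Or.inr (by simp)), ← mul_add,
      ENNReal.inv_two_add_inv_two, mul_one]⟩
  rw [← ENNReal.toReal_mul]
  refine ENNReal.toReal_mono ?_ ?_
  · exact ENNReal.mul_ne_top (memLp_of_continuous u.continuous _).eLpNorm_ne_top
      (memLp_of_continuous v.continuous _).eLpNorm_ne_top
  · have h := eLpNorm_smul_le_mul_eLpNorm (p := p * 2) (q := p * 2) (r := p) (μ := 𝕞)
      (f := ⇑v) (φ := ⇑u) v.continuous.aestronglyMeasurable u.continuous.aestronglyMeasurable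
    rw [smul_eq_mul] at h
    rwa [ContinuousMap.coe_mul]

theorem one_le_two_pow_ennreal (k : ℕ) : (1 : ℝ≥0∞) ≤ 2 ^ k := one_le_pow₀ one_le_two

/-- M. Riesz's inequality for trigonometric polynomials, for exponents that are powers of two. -/
theorem exists_riesz_bound_poly (k : ℕ) : ∃ C : ℝ, 0 ≤ C ∧ ∀ u ∈ analyticPoly,
    ∀ v ∈ antianalyticPoly, (eLpNorm u (2 ^ (k + 1)) 𝕞).toReal ≤
      C * (eLpNorm (u + v : C(UnitAddCircle, ℂ)) (2 ^ (k + 1)) 𝕞).toReal := by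
  induction k with
  | zero =>
    refine ⟨1, zero_le_one, fun u hu v hv => ?_⟩
    rw [zero_add, pow_one, one_mul, ← norm_toLp_continuous, ← norm_toLp_continuous,
      ← rieszProjection_toLp hu hv]
    exact Submodule.norm_starProjection_apply_le _ _
  | succ k ih =>
    obtain ⟨C, hC0, hC⟩ := ih
    refine ⟨2 * C + 1, by positivity, fun u hu v hv => ?_⟩
    rw [pow_succ]
    set p : ℝ≥0∞ := 2 ^ (k + 1)
    have hp : 1 ≤ p * 2 := (one_le_two_pow_ennreal (k + 1 + 1)).trans_eq (pow_succ _ _)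
    have h1 := hC (u * u) (mul_mem_analyticPoly hu hu) (-(v * v))
      (neg_mem (mul_mem_antianalyticPoly hv hv))
    -- Squares of analytic polynomials are analytic, and squares of antianalytic ones are
    -- antianalytic of mean zero. So `u²` is the analytic part of `(u + v)(u - v)`, and the bound at
    -- exponent `p` yields one at `2p`.
    have e : u * u + -(v * v) = (u + v) * (u - v) := by ring
    rw [e, eLpNorm_sq_continuous] at h1
    have h2 := eLpNorm_mul_le_continuous (u + v) (u - v) p
    have h3 : (eLpNorm (u - v : C(UnitAddCircle, ℂ)) (p * 2) 𝕞).toReal ≤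
        2 * (eLpNorm u (p * 2) 𝕞).toReal +
          (eLpNorm (u + v : C(UnitAddCircle, ℂ)) (p * 2) 𝕞).toReal := by
      have : Fact (1 ≤ p * 2) := ⟨hp⟩
      simp only [← norm_toLp_continuous]
      have e2 : u - v = (u + u) - (u + v) := by abel
      rw [e2, map_sub, map_add]
      refine (norm_sub_le _ _).trans ?_
      rw [two_mul]
      gcongr
      exact norm_add_le _ _
    set x := (eLpNorm u (p * 2) 𝕞).toReal
    set y := (eLpNorm (u + v : C(UnitAddCircle, ℂ)) (p * 2) 𝕞).toReal
    have hx : 0 ≤ x := ENNReal.toReal_nonneg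
    have hy : 0 ≤ y := ENNReal.toReal_nonneg
    have h4 : x ^ 2 ≤ C * (y * (2 * x + y)) :=
      h1.trans (mul_le_mul_of_nonneg_left (h2.trans (mul_le_mul_of_nonneg_left h3 hy)) hC0)
    -- The inequality `x² ≤ C y (2x + y)` forces `x ≤ (2C + 1) y`: otherwise `x y ≥ C y²`, and `x² >
    -- (2C + 1) x y ≥ C y (2x + y)`.
    by_contra! h5
    have h6 : 0 < x := lt_of_le_of_lt (by positivity) h5
    have h7 : y ≤ x := by nlinarith [mul_nonneg hC0 hy]
    nlinarith [mul_lt_mul_of_pos_left h5 h6, mul_nonneg (mul_nonneg hC0 hy) (sub_nonneg.2 h7),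
      mul_nonneg hC0 hy, mul_nonneg hx hy, mul_nonneg (mul_nonneg hC0 hy) hy,
      mul_nonneg (mul_nonneg hC0 hy) hx]

/-- M. Riesz's theorem: the Riesz projection is bounded in `L^p` when `p` is a power of two. -/
theorem exists_riesz_bound (k : ℕ) : ∃ C : ℝ, 0 ≤ C ∧ ∀ f : CircleL2,
    MemLp f (2 ^ (k + 1)) 𝕞 → eLpNorm (rieszProjection f) (2 ^ (k + 1)) 𝕞 ≤
      ENNReal.ofReal C * eLpNorm f (2 ^ (k + 1)) 𝕞 := by
  obtain ⟨C, hC0, hC⟩ := exists_riesz_bound_poly k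
  refine ⟨C, hC0, fun f hf => ?_⟩
  have h2p : (2 : ℝ≥0∞) ≤ 2 ^ (k + 1) := by
    rw [pow_succ]
    exact le_mul_of_one_le_left' (one_le_two_pow_ennreal k)
  set p : ℝ≥0∞ := 2 ^ (k + 1) with hp
  have hptop : p ≠ ∞ := by finiteness
  have : Fact (1 ≤ p) := ⟨one_le_two.trans h2p⟩
  have hcl : hf.toLp f ∈ closure
      ((Submodule.span ℂ (Set.range (@fourierLp (1 : ℝ) _ p _)) : Submodule ℂ (Lp ℂ p 𝕞)) :
        Set (Lp ℂ p 𝕞)) := by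
    rw [← Submodule.topologicalClosure_coe, span_fourierLp_closure_eq_top hptop]
    trivial
  obtain ⟨x, hx, hxf⟩ := mem_closure_iff_seq_limit.1 hcl
  have hw : ∀ n, ∃ u ∈ analyticPoly, ∃ v ∈ antianalyticPoly,
      ContinuousMap.toLp (E := ℂ) p 𝕞 ℂ (u + v) = x n := by
    intro n
    have h1 : x n ∈ (Submodule.span ℂ (Set.range (@fourier (1 : ℝ)))).map
        (ContinuousMap.toLp (E := ℂ) p 𝕞 ℂ : C(UnitAddCircle, ℂ) →ₗ[ℂ] Lp ℂ p 𝕞) := by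
      rw [Submodule.map_span, ← Set.range_comp]
      exact hx n
    obtain ⟨w, hw, hwx⟩ := h1
    obtain ⟨u, hu, v, hv, rfl⟩ := exists_add_of_mem_span_fourier hw
    exact ⟨u, hu, v, hv, hwx⟩
  choose u hu v hv huv using hw
  have hconv : Tendsto (fun n => eLpNorm (⇑(u n + v n) - ⇑f) p 𝕞) atTop (𝓝 0) := by
    have h1 := (Lp.tendsto_Lp_iff_tendsto_eLpNorm' _ _).1 hxf
    refine h1.congr fun n => eLpNorm_congr_ae ?_
    rw [← huv n]
    exact (ContinuousMap.coeFn_toLp 𝕞 (u n + v n)).sub hf.coeFn_toLp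
  -- Since `p ≥ 2`, the approximation in `L^p` is also one in `L²`, where the Riesz projection is
  -- known to be continuous.
  have hconv2 : Tendsto (fun n => ContinuousMap.toLp (E := ℂ) 2 𝕞 ℂ (u n + v n)) atTop (𝓝 f) := by
    rw [Lp.tendsto_Lp_iff_tendsto_eLpNorm']
    refine tendsto_of_tendsto_of_tendsto_of_le_of_le tendsto_const_nhds hconv
      (fun _ => zero_le) fun n => ?_
    have h1 : ⇑(ContinuousMap.toLp (E := ℂ) 2 𝕞 ℂ (u n + v n)) - ⇑f =ᵐ[𝕞]
        ⇑(u n + v n) - ⇑f :=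
      (ContinuousMap.coeFn_toLp 𝕞 (u n + v n)).sub (EventuallyEq.refl _ _)
    rw [eLpNorm_congr_ae h1]
    exact eLpNorm_le_eLpNorm_of_exponent_le h2p
      ((u n + v n).continuous.aestronglyMeasurable.sub (Lp.aestronglyMeasurable f))
  have hconv3 : Tendsto (fun n => ContinuousMap.toLp (E := ℂ) 2 𝕞 ℂ (u n)) atTop
      (𝓝 (rieszProjection f)) := by
    refine ((rieszProjection.continuous.tendsto f).comp hconv2).congr fun n => ?_
    exact rieszProjection_toLp (hu n) (hv n)
  -- Convergence of the analytic parts is known only in `L²`; an almost everywhere convergent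
  -- subsequence and Fatou's lemma transfer the `L^p` bound to the limit.
  obtain ⟨ns, hns, hae⟩ := (tendstoInMeasure_of_tendsto_Lp hconv3).exists_seq_tendsto_ae
  have hlim := Lp.eLpNorm_lim_le_liminf_eLpNorm (p := p)
    (fun n => Lp.aestronglyMeasurable (ContinuousMap.toLp (E := ℂ) 2 𝕞 ℂ (u (ns n)))) _ hae
  refine hlim.trans ?_
  have hb : ∀ n, eLpNorm (ContinuousMap.toLp (E := ℂ) 2 𝕞 ℂ (u (ns n))) p 𝕞 ≤
      ENNReal.ofReal (C * ‖x (ns n)‖) := by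
    intro n
    rw [eLpNorm_congr_ae (ContinuousMap.coeFn_toLp 𝕞 (u (ns n))), ← huv (ns n),
      norm_toLp_continuous,
      ENNReal.le_ofReal_iff_toReal_le (memLp_of_continuous (u (ns n)).continuous p).eLpNorm_ne_top
        (by positivity)]
    exact hC _ (hu _) _ (hv _)
  have ht : Tendsto (fun n => ENNReal.ofReal (C * ‖x (ns n)‖)) atTop
      (𝓝 (ENNReal.ofReal C * eLpNorm f p 𝕞)) := by
    have h1 : ENNReal.ofReal C * eLpNorm f p 𝕞 = ENNReal.ofReal (C * ‖hf.toLp f‖) := by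
      rw [ENNReal.ofReal_mul hC0, Lp.norm_toLp, ENNReal.ofReal_toReal hf.eLpNorm_ne_top]
    rw [h1]
    exact ENNReal.tendsto_ofReal (((hxf.comp hns.tendsto_atTop).norm).const_mul C)
  exact (liminf_le_liminf (Eventually.of_forall hb)).trans_eq ht.liminf_eq

/-! ### Bounded symbols with norm control, by the open mapping theorem -/

/-- Multiplication by a bounded element of the model space, as an operator on `L²`. -/
def mulBoundedPart (Θ : ℂ → ℂ) (f : boundedPart Θ) : CircleL2 →L[ℂ] CircleL2 :=
  ((ContinuousLinearMap.mul ℂ ℂ).holderL 𝕞 2 ∞ 2).flip (MemLp.toLp _ f.2)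

theorem mulBoundedPart_apply {Θ : ℂ → ℂ} (f : boundedPart Θ) (φ : CircleL2) :
    mulBoundedPart Θ f φ = (memLp_symbol_mul φ f).toLp _ := by
  refine Lp.ext ?_
  rw [mulBoundedPart, ContinuousLinearMap.flip_apply, ContinuousLinearMap.holderL_apply_apply]
  filter_upwards [(ContinuousLinearMap.mul ℂ ℂ).coeFn_holder (r := 2) φ (MemLp.toLp _ f.2),
    MemLp.coeFn_toLp f.2, (memLp_symbol_mul φ f).coeFn_toLp] with t h1 h2 h3
  rw [h1, h2, h3, ContinuousLinearMap.mul_apply']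

/-- The inclusion of `L^∞` in `L²`. -/
def topToL2 : Lp ℂ ∞ 𝕞 →L[ℂ] CircleL2 :=
  (ContinuousLinearMap.mul ℂ ℂ).holderL 𝕞 2 ∞ 2 (MemLp.toLp _ (memLp_fourier 0 2))

theorem coeFn_topToL2 (ψ : Lp ℂ ∞ 𝕞) : topToL2 ψ =ᵐ[𝕞] ψ := by
  rw [topToL2, ContinuousLinearMap.holderL_apply_apply]
  filter_upwards [(ContinuousLinearMap.mul ℂ ℂ).coeFn_holder (r := 2)
    (MemLp.toLp _ (memLp_fourier 0 2)) ψ, MemLp.coeFn_toLp (memLp_fourier 0 2)] with t h1 h2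
  rw [h1, h2, ContinuousLinearMap.mul_apply', fourier_zero, one_mul]

/-- The value `A_φ^Θ f`, as a bounded operator in the symbol `φ`. -/
def toeplitzEval (Θ : ℂ → ℂ) (f : boundedPart Θ) : CircleL2 →L[ℂ] modelSpace Θ :=
  (modelSpace Θ).orthogonalProjectionOnto.comp (mulBoundedPart Θ f)

/-- Being a symbol becomes a family of conditions indexed by `f`, each linear and continuous in the
pair `(A, φ)`; this is the closedness that the open mapping theorem requires. -/
theorem isSymbol_iff {Θ : ℂ → ℂ} {A : modelSpace Θ →L[ℂ] modelSpace Θ} {φ : CircleL2} :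
    IsSymbol Θ φ A ↔ ∀ f : boundedPart Θ,
      A (f : modelSpace Θ) = toeplitzEval Θ f φ := by
  have h : ∀ f : boundedPart Θ, toeplitzEval Θ f φ = truncatedToeplitz Θ φ f := fun f =>
    congrArg (modelSpace Θ).orthogonalProjectionOnto (mulBoundedPart_apply f φ)
  exact ⟨fun hA f => (hA f).trans (h f).symm, fun hA f => (hA f).trans (h f)⟩

/-- The open mapping theorem for a family of closed conditions `D i a = E i b`: if every solution
`(a, b)` can be changed to a solution `(a, J y)`, then `y` can be chosen with a norm bound. -/
theorem exists_norm_le_of_forall_exists_solution {ι X₁ X₂ Y Z : Type*}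
    [NormedAddCommGroup X₁] [NormedSpace ℂ X₁] [CompleteSpace X₁]
    [NormedAddCommGroup X₂] [NormedSpace ℂ X₂] [CompleteSpace X₂]
    [NormedAddCommGroup Y] [NormedSpace ℂ Y] [CompleteSpace Y]
    [NormedAddCommGroup Z] [NormedSpace ℂ Z]
    (D : ι → X₁ →L[ℂ] Z) (E : ι → X₂ →L[ℂ] Z) (J : Y →L[ℂ] X₂)
    (h : ∀ a b, (∀ i, D i a = E i b) → ∃ y, ∀ i, D i a = E i (J y)) :
    ∃ C : ℝ, 0 < C ∧ ∀ a b, (∀ i, D i a = E i b) →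
      ∃ y, (∀ i, D i a = E i (J y)) ∧ ‖y‖ ≤ C * max ‖a‖ ‖b‖ := by
  let F : ι → X₁ × X₂ →L[ℂ] Z := fun i =>
    (D i).comp (ContinuousLinearMap.fst ℂ X₁ X₂) - (E i).comp (ContinuousLinearMap.snd ℂ X₁ X₂)
  have hF : ∀ i a b, F i (a, b) = 0 ↔ D i a = E i b := fun i a b => sub_eq_zero
  let G : Submodule ℂ (X₁ × X₂) := ⨅ i, (F i).ker
  let F' : ι → (X₁ × X₂) × Y →L[ℂ] Z := fun i => (F i).comp
    (((ContinuousLinearMap.fst ℂ X₁ X₂).comp (ContinuousLinearMap.fst ℂ (X₁ × X₂) Y)).prod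
      (J.comp (ContinuousLinearMap.snd ℂ (X₁ × X₂) Y)))
  -- Solutions together with an admissible `y`. Both `S` and `G` are closed, and the hypothesis says
  -- precisely that the projection `S → G` is onto.
  let S : Submodule ℂ ((X₁ × X₂) × Y) :=
    G.comap (LinearMap.fst ℂ (X₁ × X₂) Y) ⊓ ⨅ i, (F' i).ker
  have hG : ∀ a b, (a, b) ∈ G ↔ ∀ i, D i a = E i b := fun a b =>
    (Submodule.mem_iInf _).trans (forall_congr' fun i => hF i a b)
  have hS : ∀ a b y, ((a, b), y) ∈ S ↔ (a, b) ∈ G ∧ ∀ i, D i a = E i (J y) := fun a b y =>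
    and_congr Iff.rfl ((Submodule.mem_iInf _).trans (forall_congr' fun i => hF i a (J y)))
  have hGc : IsClosed (G : Set (X₁ × X₂)) := by
    rw [Submodule.coe_iInf]
    exact isClosed_iInter fun i => (F i).isClosed_ker
  have hSc : IsClosed (S : Set ((X₁ × X₂) × Y)) := by
    refine (hGc.preimage continuous_fst).inter ?_
    rw [Submodule.coe_iInf]
    exact isClosed_iInter fun i => (F' i).isClosed_ker
  have : CompleteSpace S := hSc.completeSpace_coe
  have : CompleteSpace G := hGc.completeSpace_coe
  let T : S →L[ℂ] G := ((ContinuousLinearMap.fst ℂ (X₁ × X₂) Y).comp S.subtypeL).codRestrict G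
    fun z => ((hS _ _ _).1 z.2).1
  have hT : Function.Surjective T := by
    rintro ⟨⟨a, b⟩, hx⟩
    obtain ⟨y, hy⟩ := h a b ((hG _ _).1 hx)
    exact ⟨⟨((a, b), y), (hS _ _ _).2 ⟨hx, hy⟩⟩, rfl⟩
  obtain ⟨C, hC, hCT⟩ := ContinuousLinearMap.exists_preimage_norm_le T hT
  refine ⟨C, hC, fun a b hab => ?_⟩
  obtain ⟨⟨⟨x', y⟩, hz⟩, hzx, hn⟩ := hCT ⟨(a, b), (hG _ _).2 hab⟩
  obtain rfl : x' = (a, b) := congrArg Subtype.val hzx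
  exact ⟨y, ((hS _ _ _).1 hz).2, (norm_snd_le ((a, b), y)).trans hn⟩

/-- The case where the first unknown is an operator tested on the vectors `e i`. -/
theorem exists_norm_le_of_forall_exists_operator_solution {ι K X Y : Type*}
    [NormedAddCommGroup K] [NormedSpace ℂ K] [CompleteSpace K]
    [NormedAddCommGroup X] [NormedSpace ℂ X] [CompleteSpace X]
    [NormedAddCommGroup Y] [NormedSpace ℂ Y] [CompleteSpace Y]
    (e : ι → K) (E : ι → X →L[ℂ] K) (J : Y →L[ℂ] X)
    (h : ∀ (A : K →L[ℂ] K) b, (∀ i, A (e i) = E i b) → ∃ y, ∀ i, A (e i) = E i (J y)) :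
    ∃ C : ℝ, 0 < C ∧ ∀ (A : K →L[ℂ] K) b, (∀ i, A (e i) = E i b) →
      ∃ y, (∀ i, A (e i) = E i (J y)) ∧ ‖y‖ ≤ C * max ‖A‖ ‖b‖ :=
  exists_norm_le_of_forall_exists_solution (fun i => ContinuousLinearMap.apply ℂ K (e i)) E J h

/-- If every bounded truncated Toeplitz operator has a bounded symbol, then the bounded symbol can
be chosen with norm controlled by the operator and by any given square integrable symbol. -/
theorem exists_boundedSymbol_norm_le {Θ : ℂ → ℂ}
    (hsymb : ∀ A ∈ boundedTruncatedToeplitz Θ, HasBoundedSymbol Θ A) :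
    ∃ C : ℝ, 0 < C ∧ ∀ (A : modelSpace Θ →L[ℂ] modelSpace Θ) (φ : CircleL2), IsSymbol Θ φ A →
      ∃ ψ : CircleL2, IsSymbol Θ ψ A ∧
        eLpNorm ψ ∞ 𝕞 ≤ ENNReal.ofReal (C * max ‖A‖ ‖φ‖) := by
  have h : ∀ (A : modelSpace Θ →L[ℂ] modelSpace Θ) (φ : CircleL2),
      (∀ f : boundedPart Θ, A f = toeplitzEval Θ f φ) →
      ∃ ψ : Lp ℂ ∞ 𝕞, ∀ f : boundedPart Θ, A f = toeplitzEval Θ f (topToL2 ψ) := by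
    intro A φ hA
    obtain ⟨ψ, hψ, hs⟩ := hsymb A ⟨φ, isSymbol_iff.2 hA⟩
    have h2 : topToL2 (hψ.toLp ψ) = ψ := Lp.ext ((coeFn_topToL2 _).trans hψ.coeFn_toLp)
    refine ⟨hψ.toLp ψ, ?_⟩
    rw [h2]
    exact isSymbol_iff.1 hs
  obtain ⟨C, hC, hCb⟩ := exists_norm_le_of_forall_exists_operator_solution
    (fun f : boundedPart Θ => (f : modelSpace Θ)) (toeplitzEval Θ) topToL2 h
  refine ⟨C, hC, fun A φ hA => ?_⟩
  obtain ⟨ψ, hx, hn⟩ := hCb A φ (isSymbol_iff.1 hA)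
  refine ⟨topToL2 ψ, isSymbol_iff.2 hx, ?_⟩
  rw [eLpNorm_congr_ae (coeFn_topToL2 ψ)]
  refine (ENNReal.le_ofReal_iff_toReal_le (Lp.eLpNorm_ne_top ψ) ?_).2 ?_
  · exact mul_nonneg hC.le ((norm_nonneg A).trans (le_max_left _ _))
  · rw [← Lp.norm_def]
    exact hn

/-! ### Kernels and conjugate kernels in the model space -/

/-- The boundary function of the reproducing kernel `k_l^Θ`. -/
def boundaryKernel (Θ : ℂ → ℂ) (l : ℂ) (t : UnitAddCircle) : ℂ :=
  szego l t * (1 - conj (Θ l) * radialLimit Θ t)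

/-- The boundary function `(Θ - Θ(l)) / (z - l)` of the conjugate kernel. -/
def conjugateKernel (Θ : ℂ → ℂ) (l : ℂ) (t : UnitAddCircle) : ℂ :=
  conj (fourier 1 t) * conj (szego l t) * (radialLimit Θ t - Θ l)

/-- A function on the circle belongs to the model space `K_Θ`. -/
structure IsModel (Θ : ℂ → ℂ) (f : UnitAddCircle → ℂ) : Prop where
  isHardy : IsHardy f
  orthogonal : ∀ h, IsHardy h → ∫ t, conj (radialLimit Θ t * h t) * f t ∂𝕞 = 0

theorem integrable_conj {f : UnitAddCircle → ℂ} (hf : Integrable f 𝕞) :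
    Integrable (fun t => conj (f t)) 𝕞 :=
  memLp_one_iff_integrable.1 (memLp_conj (memLp_one_iff_integrable.2 hf))

theorem integral_conj_szego {l : ℂ} (hl : ‖l‖ < 1) : ∫ t, conj (szego l t) ∂𝕞 = 1 := by
  have h : IsBoundaryValue (fun _ => 1) (fun _ => 1) :=
    ⟨differentiableOn_const _, ⟨1, fun _ _ => by simp⟩, ae_of_all _ fun _ => tendsto_const_nhds⟩
  simpa only [mul_one] using h.integral_szego_mul hl

theorem isHardy_szego {l : ℂ} (hl : ‖l‖ < 1) : IsHardy (szego l) :=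
  (isBoundaryValue_szego hl).isHardy

/-- The Riesz projection is orthogonal, in integral form. -/
theorem integral_conj_mul_rieszProjection {h : UnitAddCircle → ℂ} (hh : IsHardy h) (X : CircleL2) :
    ∫ t, conj (h t) * rieszProjection X t ∂𝕞 = ∫ t, conj (h t) * X t ∂𝕞 := by
  have h1 : inner ℂ (hh.memLp.toLp h) (rieszProjection X) = inner ℂ (hh.memLp.toLp h) X := by
    rw [rieszProjection, ← Submodule.inner_starProjection_left_eq_right,
      Submodule.starProjection_eq_self_iff.2 hh.toLp_mem]
  rw [inner_eq_integral, inner_eq_integral] at h1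
  have h2 : ∀ Y : CircleL2, ∫ t, conj (hh.memLp.toLp h t) * Y t ∂𝕞 = ∫ t, conj (h t) * Y t ∂𝕞 := by
    intro Y
    refine integral_congr_ae ?_
    filter_upwards [hh.memLp.coeFn_toLp] with t ht
    rw [ht]
  rwa [h2, h2] at h1

theorem isHardy_rieszProjection (X : CircleL2) : IsHardy (rieszProjection X) :=
  (mem_hardySpace_iff _).1 (Submodule.starProjection_apply_mem _ _)

namespace IsInner

variable {Θ : ℂ → ℂ}

theorem memLp_radialLimit (hΘ : IsInner Θ) : MemLp (radialLimit Θ) ∞ 𝕞 :=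
  hΘ.isBoundaryValue.memLp_top

theorem isHardy_radialLimit (hΘ : IsInner Θ) : IsHardy (radialLimit Θ) :=
  hΘ.isBoundaryValue.isHardy

theorem ae_conj_mul_radialLimit (hΘ : IsInner Θ) :
    ∀ᵐ t ∂𝕞, conj (radialLimit Θ t) * radialLimit Θ t = 1 := by
  filter_upwards [hΘ.ae_radialLimit] with t ht
  rw [Complex.conj_mul', ht.1]
  simp

theorem mem_modelSpace_iff (hΘ : IsInner Θ) (f : CircleL2) : f ∈ modelSpace Θ ↔ IsModel Θ f := by
  rw [modelSpace, Submodule.mem_inf, mem_hardySpace_iff, Submodule.mem_orthogonal]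
  constructor
  · rintro ⟨h1, h2⟩
    refine ⟨h1, fun h hh => ?_⟩
    have hm : MemLp (fun t => radialLimit Θ t * h t) 2 𝕞 :=
      memLp_bdd_mul hΘ.memLp_radialLimit hh.memLp
    have h3 := h2 (hm.toLp _) ⟨hh.memLp.toLp h, hh.toLp_mem, by
      filter_upwards [hm.coeFn_toLp, hh.memLp.coeFn_toLp] with t a b
      rw [a, b]⟩
    rw [inner_eq_integral] at h3
    rw [← h3]
    refine integral_congr_ae ?_
    filter_upwards [hm.coeFn_toLp] with t a
    rw [a]
  · rintro ⟨h1, h2⟩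
    refine ⟨h1, ?_⟩
    rintro u ⟨g, hg, hu⟩
    rw [inner_eq_integral, ← h2 g ((mem_hardySpace_iff g).1 hg)]
    refine integral_congr_ae ?_
    filter_upwards [hu] with t a
    rw [a]

end IsInner

theorem IsModel.congr {Θ : ℂ → ℂ} {f g : UnitAddCircle → ℂ} (hf : IsModel Θ f) (h : f =ᵐ[𝕞] g) :
    IsModel Θ g := by
  refine ⟨hf.isHardy.congr h, fun k hk => ?_⟩
  rw [← hf.orthogonal k hk]
  refine integral_congr_ae ?_
  filter_upwards [h] with t ht
  rw [ht]

theorem IsModel.toLp_mem {Θ : ℂ → ℂ} {f : UnitAddCircle → ℂ} (hf : IsModel Θ f) (hΘ : IsInner Θ) :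
    hf.isHardy.memLp.toLp f ∈ modelSpace Θ :=
  (hΘ.mem_modelSpace_iff _).2 (hf.congr hf.isHardy.memLp.coeFn_toLp.symm)

namespace IsInner

variable {Θ : ℂ → ℂ}

theorem memLp_boundaryKernel (hΘ : IsInner Θ) {l : ℂ} (hl : ‖l‖ < 1) :
    MemLp (boundaryKernel Θ l) ∞ 𝕞 :=
  memLp_bdd_mul (memLp_szego hl ∞)
    ((memLp_const (1 : ℂ)).sub (hΘ.memLp_radialLimit.const_mul (conj (Θ l))))

theorem memLp_conjugateKernel (hΘ : IsInner Θ) {l : ℂ} (hl : ‖l‖ < 1) :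
    MemLp (conjugateKernel Θ l) ∞ 𝕞 :=
  memLp_bdd_mul (memLp_bdd_mul (memLp_conj (memLp_fourier 1 ∞)) (memLp_conj (memLp_szego hl ∞)))
    (hΘ.memLp_radialLimit.sub (memLp_const (Θ l)))

theorem isHardy_boundaryKernel (hΘ : IsInner Θ) {l : ℂ} (hl : ‖l‖ < 1) :
    IsHardy (boundaryKernel Θ l) :=
  (isHardy_szego hl).mul (memLp_szego hl ∞)
    ((IsHardy.const 1).sub (hΘ.isHardy_radialLimit.const_mul (conj (Θ l))))

theorem isHardy_conjugateKernel (hΘ : IsInner Θ) {l : ℂ} (hl : ‖l‖ < 1) :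
    IsHardy (conjugateKernel Θ l) := by
  refine (hΘ.isHardy_radialLimit.sub (IsHardy.const (Θ l))).div_sub hl ?_
  simp only [mul_sub]
  rw [integral_sub, hΘ.isBoundaryValue.integral_szego_mul hl, integral_mul_const,
    integral_conj_szego hl, one_mul, sub_self]
  · exact integrable_mul_L2 (memLp_conj (memLp_szego hl 2)) hΘ.isHardy_radialLimit.memLp
  · exact ((memLp_conj (memLp_szego hl 2)).integrable one_le_two).mul_const _

/-- Almost everywhere on the circle `conj Θ · k_l = conj (z k̃_l)`, so orthogonality to `Θ h` says
that `z k̃_l h` has mean zero. -/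
theorem isModel_boundaryKernel (hΘ : IsInner Θ) {l : ℂ} (hl : ‖l‖ < 1) :
    IsModel Θ (boundaryKernel Θ l) := by
  refine ⟨hΘ.isHardy_boundaryKernel hl, fun h hh => ?_⟩
  have h1 := (hΘ.isHardy_conjugateKernel hl).integral_fourier_mul_mul hh one_pos
  rw [← map_zero (starRingEnd ℂ), ← h1, ← integral_conj]
  refine integral_congr_ae ?_
  filter_upwards [hΘ.ae_conj_mul_radialLimit] with t ht
  have h2 := fourier_mul_conj 1 t
  simp only [boundaryKernel, conjugateKernel, map_mul, map_sub, Complex.conj_conj]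
  linear_combination (-conj (h t) * szego l t * conj (Θ l)) * ht -
    (szego l t * (conj (radialLimit Θ t) - conj (Θ l)) * conj (h t)) * h2

/-- The mirror identity `conj Θ · k̃_l = conj (z k_l)` does the same with the two kernels exchanged.
-/
theorem isModel_conjugateKernel (hΘ : IsInner Θ) {l : ℂ} (hl : ‖l‖ < 1) :
    IsModel Θ (conjugateKernel Θ l) := by
  refine ⟨hΘ.isHardy_conjugateKernel hl, fun h hh => ?_⟩
  have h1 := (hΘ.isHardy_boundaryKernel hl).integral_fourier_mul_mul hh one_pos
  rw [← map_zero (starRingEnd ℂ), ← h1, ← integral_conj]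
  refine integral_congr_ae ?_
  filter_upwards [hΘ.ae_conj_mul_radialLimit] with t ht
  simp only [boundaryKernel, conjugateKernel, map_mul, map_sub, Complex.conj_conj, map_one]
  linear_combination (conj (h t) * conj (szego l t) * conj (fourier 1 t)) * ht

/-- The reproducing property of the boundary kernel on the model space. -/
theorem integral_conj_boundaryKernel_mul (hΘ : IsInner Θ) {l : ℂ} (hl : ‖l‖ < 1)
    {f : UnitAddCircle → ℂ} (hf : IsModel Θ f) :
    ∫ t, conj (boundaryKernel Θ l t) * f t ∂𝕞 = ∫ t, conj (szego l t) * f t ∂𝕞 := by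
  have h1 := hf.orthogonal _ (isHardy_szego hl)
  have e : ∀ t, conj (boundaryKernel Θ l t) * f t = conj (szego l t) * f t -
      Θ l * (conj (radialLimit Θ t * szego l t) * f t) := by
    intro t
    simp only [boundaryKernel, map_mul, map_sub, Complex.conj_conj, map_one]
    ring
  simp_rw [e]
  rw [integral_sub, integral_const_mul, h1, mul_zero, sub_zero]
  · exact integrable_mul_L2 (memLp_conj (memLp_szego hl 2)) hf.isHardy.memLp
  · exact (integrable_mul_L2 (memLp_conj (memLp_bdd_mul hΘ.memLp_radialLimit (memLp_szego hl 2)))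
      hf.isHardy.memLp).const_mul _

/-! ### The rank one operator, its symbol, and the projection onto the model space -/

/-- A bounded symbol of the rank one operator `f ↦ f(l) (Θ - Θ(l)) / (z - l)`. -/
def _root_.rankOneSymbol (Θ : ℂ → ℂ) (l : ℂ) (t : UnitAddCircle) : ℂ :=
  conjugateKernel Θ l t + Θ l * (conj (fourier 1 t) * conj (boundaryKernel Θ l t))

theorem memLp_rankOneSymbol (hΘ : IsInner Θ) {l : ℂ} (hl : ‖l‖ < 1) :
    MemLp (rankOneSymbol Θ l) ∞ 𝕞 :=
  (hΘ.memLp_conjugateKernel hl).add ((memLp_bdd_mul (memLp_conj (memLp_fourier 1 ∞))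
    (memLp_conj (hΘ.memLp_boundaryKernel hl))).const_mul _)

/-- With `c = f(l)`, this says that `φ f - f(l) k̃_l` is orthogonal to `K_Θ`, where `φ` is the rank
one symbol. -/
theorem integral_conj_mul_rankOneSymbol (hΘ : IsInner Θ) {l : ℂ} (hl : ‖l‖ < 1)
    {f g : UnitAddCircle → ℂ} (hf : IsModel Θ f) (hg : IsModel Θ g) {c : ℂ}
    (hc : ∫ t, conj (szego l t) * f t ∂𝕞 = c) :
    ∫ t, conj (g t) * (rankOneSymbol Θ l t * f t - c * conjugateKernel Θ l t) ∂𝕞 = 0 := by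
  have hQ : IsHardy (fun t => conj (fourier 1 t) * conj (szego l t) * (f t - c)) := by
    refine (hf.isHardy.sub (IsHardy.const c)).div_sub hl ?_
    simp only [mul_sub]
    rw [integral_sub, hc, integral_mul_const, integral_conj_szego hl, one_mul, sub_self]
    · exact integrable_mul_L2 (memLp_conj (memLp_szego hl 2)) hf.isHardy.memLp
    · exact ((memLp_conj (memLp_szego hl 2)).integrable one_le_two).mul_const _
  have hsg : IsHardy (fun t => szego l t * g t) :=
    (isHardy_szego hl).mul (memLp_szego hl ∞) hg.isHardy
  have hesg : IsHardy (fun t => fourier 1 t * (szego l t * g t)) :=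
    (IsHardy.fourier_nonneg zero_le_one).mul (memLp_fourier 1 ∞) hsg
  have h1 := hg.orthogonal _ hQ
  have h2 := hsg.integral_fourier_one_mul
  have h3 := hf.orthogonal _ hesg
  have i1 := integrable_mul_L2 (memLp_conj (memLp_bdd_mul hΘ.memLp_radialLimit hQ.memLp))
    hg.isHardy.memLp
  have i2 := (hesg.memLp).integrable one_le_two
  have i3 := integrable_mul_L2 (memLp_conj (memLp_bdd_mul hΘ.memLp_radialLimit hesg.memLp))
    hf.isHardy.memLp
  have h1' := congrArg conj h1
  have h2' := congrArg conj h2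
  rw [← integral_conj, map_zero] at h1' h2'
  have i1' := integrable_conj i1
  have i2' := integrable_conj i2
  -- On the circle the symbol is `(Θ - Θ(l)² conj Θ) / (z - l)`. The difference therefore splits
  -- into `Θ (f - c) / (z - l)`, which lies in `Θ H²`; `Θ(l) c / (z - l)`, which is orthogonal to
  -- `H²`; and a multiple of `conj Θ · f / (z - l)`, whose pairing with `g` is that of `f` with `Θ z
  -- s_l g ∈ Θ H²`.
  have e : ∀ t, conj (g t) * (rankOneSymbol Θ l t * f t - c * conjugateKernel Θ l t) =
      conj (conj (radialLimit Θ t * (conj (fourier 1 t) * conj (szego l t) * (f t - c))) * g t) +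
      (Θ l * c) * conj (fourier 1 t * (szego l t * g t)) -
      Θ l ^ 2 * (conj (radialLimit Θ t * (fourier 1 t * (szego l t * g t))) * f t) := by
    intro t
    simp only [rankOneSymbol, boundaryKernel, conjugateKernel, map_mul, map_sub,
      Complex.conj_conj, map_one]
    ring
  simp_rw [e]
  have i12 := i1'.add (i2'.const_mul (Θ l * c))
  refine (integral_sub i12 (i3.const_mul _)).trans ?_
  rw [integral_const_mul, h3, mul_zero, sub_zero]
  refine (integral_add i1' (i2'.const_mul _)).trans ?_
  rw [integral_const_mul, h1', h2', mul_zero, add_zero]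

/-- From `|Θ| = 1` comes `Θ - Θ(l) = Θ · conj (1 - conj Θ(l) · Θ)`. Norm estimates for `k̃_l`
thereby become estimates for `k_l`. -/
theorem norm_boundaryKernel_eq (hΘ : IsInner Θ) (l : ℂ) :
    ∀ᵐ t ∂𝕞, ‖conjugateKernel Θ l t‖ = ‖boundaryKernel Θ l t‖ := by
  filter_upwards [hΘ.ae_conj_mul_radialLimit, hΘ.ae_radialLimit] with t ht ht2
  have h1 : radialLimit Θ t - Θ l =
      radialLimit Θ t * conj (1 - conj (Θ l) * radialLimit Θ t) := by
    simp only [map_sub, map_mul, map_one, Complex.conj_conj]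
    linear_combination Θ l * ht
  rw [conjugateKernel, boundaryKernel, h1, norm_mul, norm_mul, norm_mul, norm_mul,
    RCLike.norm_conj, RCLike.norm_conj, RCLike.norm_conj, norm_fourier_apply, ht2.1, one_mul,
    one_mul]

theorem norm_rankOneSymbol_le (hΘ : IsInner Θ) {l : ℂ} (hl : ‖l‖ < 1) :
    ∀ᵐ t ∂𝕞, ‖rankOneSymbol Θ l t‖ ≤ 2 * ‖boundaryKernel Θ l t‖ := by
  filter_upwards [hΘ.norm_boundaryKernel_eq l] with t ht
  refine (norm_add_le _ _).trans ?_
  rw [ht, norm_mul, norm_mul, RCLike.norm_conj, RCLike.norm_conj, norm_fourier_apply, one_mul,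
    two_mul]
  have := mul_le_mul_of_nonneg_right (hΘ.norm_le_one hl) (norm_nonneg (boundaryKernel Θ l t))
  linarith

/-- The projection onto the model space in terms of the Riesz projection. -/
theorem starProjection_modelSpace (hΘ : IsInner Θ) (X Y : CircleL2)
    (hXY : Y =ᵐ[𝕞] fun t => conj (radialLimit Θ t) * X t) :
    (modelSpace Θ).starProjection X =ᵐ[𝕞]
      fun t => rieszProjection X t - radialLimit Θ t * rieszProjection Y t := by
  have hX := isHardy_rieszProjection X
  have hY := isHardy_rieszProjection Y
  have hθY : IsHardy (fun t => radialLimit Θ t * rieszProjection Y t) :=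
    hΘ.isHardy_radialLimit.mul hΘ.memLp_radialLimit hY
  -- For `h ∈ H²`, `⟨Θ h, P₊X⟩ = ⟨h, conj Θ · X⟩ = ⟨h, P₊Y⟩`, so the two terms cancel against `Θ h`.
  have hm : IsModel Θ
      (fun t => rieszProjection X t - radialLimit Θ t * rieszProjection Y t) := by
    refine ⟨hX.sub hθY, fun h hh => ?_⟩
    have hθh : IsHardy (fun t => radialLimit Θ t * h t) :=
      hΘ.isHardy_radialLimit.mul hΘ.memLp_radialLimit hh
    have e : ∫ t, conj (radialLimit Θ t * h t) *
        (rieszProjection X t - radialLimit Θ t * rieszProjection Y t) ∂𝕞 =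
        ∫ t, (conj (radialLimit Θ t * h t) * rieszProjection X t -
          conj (h t) * rieszProjection Y t) ∂𝕞 := by
      refine integral_congr_ae ?_
      filter_upwards [hΘ.ae_conj_mul_radialLimit] with t ht
      rw [map_mul]
      linear_combination (-conj (h t) * rieszProjection Y t) * ht
    rw [e, integral_sub (integrable_mul_L2 (memLp_conj hθh.memLp) hX.memLp)
      (integrable_mul_L2 (memLp_conj hh.memLp) hY.memLp), integral_conj_mul_rieszProjection hθh,
      integral_conj_mul_rieszProjection hh, sub_eq_zero]
    refine integral_congr_ae ?_
    filter_upwards [hXY] with t ht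
    rw [ht, map_mul]
    ring
  have hP : (modelSpace Θ).starProjection X = hm.isHardy.memLp.toLp _ := by
    refine Submodule.eq_starProjection_of_mem_of_inner_eq_zero (hm.toLp_mem hΘ) fun g hg => ?_
    have hg' := (hΘ.mem_modelSpace_iff g).1 hg
    rw [← inner_conj_symm, inner_sub_right, inner_eq_integral, inner_eq_integral,
      ← integral_conj_mul_rieszProjection hg'.isHardy]
    have e : ∫ t, conj (g t) * (hm.isHardy.memLp.toLp _ : CircleL2) t ∂𝕞 =
        ∫ t, (conj (g t) * rieszProjection X t -
          conj (conj (radialLimit Θ t * rieszProjection Y t) * g t)) ∂𝕞 := by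
      refine integral_congr_ae ?_
      filter_upwards [hm.isHardy.memLp.coeFn_toLp] with t ht
      rw [ht, map_mul, Complex.conj_conj]
      ring
    rw [e, integral_sub (integrable_mul_L2 (memLp_conj hg'.isHardy.memLp) hX.memLp)
      (integrable_conj (integrable_mul_L2 (memLp_conj hθY.memLp) hg'.isHardy.memLp)), integral_conj,
      hg'.orthogonal _ hY, map_zero, sub_zero, sub_self, map_zero]
  rw [hP]
  exact hm.isHardy.memLp.coeFn_toLp

end IsInner

namespace IsInner

variable {Θ : ℂ → ℂ}

/-! ### Operator norms and test vectors -/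

/-- The reproducing kernel as an element of the model space. -/
def kernelElement (hΘ : IsInner Θ) {l : ℂ} (hl : ‖l‖ < 1) : modelSpace Θ :=
  ⟨_, (hΘ.isModel_boundaryKernel hl).toLp_mem hΘ⟩

/-- The conjugate kernel as an element of the model space. -/
def conjugateKernelElement (hΘ : IsInner Θ) {l : ℂ} (hl : ‖l‖ < 1) : modelSpace Θ :=
  ⟨_, (hΘ.isModel_conjugateKernel hl).toLp_mem hΘ⟩

theorem coeFn_kernelElement (hΘ : IsInner Θ) {l : ℂ} (hl : ‖l‖ < 1) :
    (hΘ.kernelElement hl : CircleL2) =ᵐ[𝕞] boundaryKernel Θ l :=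
  (hΘ.isHardy_boundaryKernel hl).memLp.coeFn_toLp

theorem coeFn_conjugateKernelElement (hΘ : IsInner Θ) {l : ℂ} (hl : ‖l‖ < 1) :
    (hΘ.conjugateKernelElement hl : CircleL2) =ᵐ[𝕞] conjugateKernel Θ l :=
  (hΘ.isHardy_conjugateKernel hl).memLp.coeFn_toLp

/-- The Szegő integral plays the role of the value `f(l)`, since elements of the model space are
only boundary classes. -/
theorem inner_kernelElement (hΘ : IsInner Θ) {l : ℂ} (hl : ‖l‖ < 1) (f : modelSpace Θ) :
    inner ℂ (hΘ.kernelElement hl) f = ∫ t, conj (szego l t) * (f : CircleL2) t ∂𝕞 := by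
  rw [← hΘ.integral_conj_boundaryKernel_mul hl ((hΘ.mem_modelSpace_iff _).1 f.2),
    Submodule.coe_inner, inner_eq_integral]
  refine integral_congr_ae ?_
  filter_upwards [hΘ.coeFn_kernelElement hl] with t ht
  rw [ht]

theorem norm_conjugateKernelElement (hΘ : IsInner Θ) {l : ℂ} (hl : ‖l‖ < 1) :
    ‖hΘ.conjugateKernelElement hl‖ = ‖hΘ.kernelElement hl‖ := by
  rw [Submodule.coe_norm, Submodule.coe_norm, Lp.norm_def, Lp.norm_def]
  congr 1
  refine eLpNorm_congr_norm_ae ?_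
  filter_upwards [hΘ.coeFn_kernelElement hl, hΘ.coeFn_conjugateKernelElement hl,
    hΘ.norm_boundaryKernel_eq l] with t h1 h2 h3
  rw [h1, h2, h3]

/-- The rank one operator `f ↦ f(l) (Θ - Θ(l)) / (z - l)` on the model space. -/
def rankOneOperator (hΘ : IsInner Θ) {l : ℂ} (hl : ‖l‖ < 1) :
    modelSpace Θ →L[ℂ] modelSpace Θ :=
  (innerSL ℂ (hΘ.kernelElement hl)).smulRight (hΘ.conjugateKernelElement hl)

theorem rankOneOperator_apply (hΘ : IsInner Θ) {l : ℂ} (hl : ‖l‖ < 1) (f : modelSpace Θ) :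
    hΘ.rankOneOperator hl f =
      inner ℂ (hΘ.kernelElement hl) f • hΘ.conjugateKernelElement hl := rfl

theorem norm_rankOneOperator_le (hΘ : IsInner Θ) {l : ℂ} (hl : ‖l‖ < 1) :
    ‖hΘ.rankOneOperator hl‖ ≤ ‖hΘ.kernelElement hl‖ ^ 2 := by
  refine ContinuousLinearMap.opNorm_le_bound _ (sq_nonneg _) fun f => ?_
  rw [rankOneOperator_apply, norm_smul, norm_conjugateKernelElement]
  have := norm_inner_le_norm (𝕜 := ℂ) (hΘ.kernelElement hl) f
  nlinarith [norm_nonneg (hΘ.kernelElement hl)]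

theorem isSymbol_rankOneSymbol (hΘ : IsInner Θ) {l : ℂ} (hl : ‖l‖ < 1) :
    IsSymbol Θ (((hΘ.memLp_rankOneSymbol hl).mono_exponent le_top).toLp _)
      (hΘ.rankOneOperator hl) := by
  refine isSymbol_iff.2 fun f => Subtype.ext ?_
  change _ = (modelSpace Θ).starProjection (mulBoundedPart Θ f _)
  rw [mulBoundedPart_apply]
  refine (Submodule.eq_starProjection_of_mem_of_inner_eq_zero (Subtype.property _)
    fun g hg => ?_).symm
  have hf := (hΘ.mem_modelSpace_iff _).1 (f : modelSpace Θ).2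
  have h1 := hΘ.integral_conj_mul_rankOneSymbol hl hf ((hΘ.mem_modelSpace_iff g).1 hg)
    (hΘ.inner_kernelElement hl f).symm
  rw [← inner_conj_symm, ← map_zero (starRingEnd ℂ), ← h1, inner_eq_integral]
  congr 1
  refine integral_congr_ae ?_
  rw [rankOneOperator_apply, Submodule.coe_smul]
  filter_upwards [Lp.coeFn_sub ((memLp_symbol_mul
      (((hΘ.memLp_rankOneSymbol hl).mono_exponent le_top).toLp _ : CircleL2) f).toLp _)
      (inner ℂ (hΘ.kernelElement hl) (f : modelSpace Θ) •
        (hΘ.conjugateKernelElement hl : CircleL2)),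
    (memLp_symbol_mul (((hΘ.memLp_rankOneSymbol hl).mono_exponent le_top).toLp _ : CircleL2)
      f).coeFn_toLp,
    Lp.coeFn_smul (inner ℂ (hΘ.kernelElement hl) (f : modelSpace Θ))
      (hΘ.conjugateKernelElement hl : CircleL2),
    hΘ.coeFn_conjugateKernelElement hl,
    ((hΘ.memLp_rankOneSymbol hl).mono_exponent (p := 2) le_top).coeFn_toLp] with t a b c d e
  rw [a, Pi.sub_apply, b, c, Pi.smul_apply, d, e, smul_eq_mul]

theorem norm_toLp_rankOneSymbol_le (hΘ : IsInner Θ) {l : ℂ} (hl : ‖l‖ < 1) :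
    ‖(((hΘ.memLp_rankOneSymbol hl).mono_exponent le_top).toLp _ : CircleL2)‖ ≤
      2 * ‖hΘ.kernelElement hl‖ := by
  rw [Submodule.coe_norm]
  refine Lp.norm_le_mul_norm_of_ae_le_mul ?_
  filter_upwards [hΘ.coeFn_kernelElement hl, hΘ.norm_rankOneSymbol_le hl,
    ((hΘ.memLp_rankOneSymbol hl).mono_exponent (p := 2) le_top).coeFn_toLp] with t h1 h2 h3
  rw [h1, h3]
  exact h2

theorem szego_zero (t : UnitAddCircle) : szego 0 t = 1 := by
  rw [szego, map_zero, zero_mul, sub_zero, inv_one]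

theorem inner_kernelElement_zero (hΘ : IsInner Θ) {l : ℂ} (hl : ‖l‖ < 1) (h0 : ‖(0 : ℂ)‖ < 1) :
    inner ℂ (hΘ.kernelElement hl) (hΘ.kernelElement h0) = 1 - conj (Θ 0) * Θ l := by
  rw [inner_kernelElement]
  have e : ∫ t, conj (szego l t) * (hΘ.kernelElement h0 : CircleL2) t ∂𝕞 =
      ∫ t, (conj (szego l t) - conj (Θ 0) * (conj (szego l t) * radialLimit Θ t)) ∂𝕞 := by
    refine integral_congr_ae ?_
    filter_upwards [hΘ.coeFn_kernelElement h0] with t ht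
    rw [ht, boundaryKernel, szego_zero]
    ring
  rw [e, integral_sub ((memLp_conj (memLp_szego hl 2)).integrable one_le_two)
    ((integrable_mul_L2 (memLp_conj (memLp_szego hl 2)) hΘ.isHardy_radialLimit.memLp).const_mul _),
    integral_const_mul, integral_conj_szego hl, hΘ.isBoundaryValue.integral_szego_mul hl]

/-- A lower bound for `|k_0(l)|` uniform in `l`. It serves both to divide by `k_0(l)` and to bound
`‖k_l‖₂` from below. -/
theorem le_norm_inner_kernelElement_zero (hΘ : IsInner Θ) {l : ℂ} (hl : ‖l‖ < 1)
    (h0 : ‖(0 : ℂ)‖ < 1) :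
    1 - ‖Θ 0‖ ≤ ‖(inner ℂ (hΘ.kernelElement hl) (hΘ.kernelElement h0) : ℂ)‖ := by
  rw [inner_kernelElement_zero]
  have h1 := norm_sub_norm_le (1 : ℂ) (conj (Θ 0) * Θ l)
  rw [norm_one, norm_mul, RCLike.norm_conj] at h1
  nlinarith [hΘ.norm_le_one hl, norm_nonneg (Θ 0)]

theorem norm_boundaryKernel_zero_le (hΘ : IsInner Θ) :
    ∀ᵐ t ∂𝕞, ‖boundaryKernel Θ 0 t‖ ≤ 2 := by
  filter_upwards [hΘ.ae_radialLimit] with t ht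
  rw [boundaryKernel, szego_zero, one_mul]
  refine (norm_sub_le _ _).trans ?_
  rw [norm_one, norm_mul, RCLike.norm_conj, ht.1, mul_one]
  have := hΘ.norm_le_one (l := 0) (by simp)
  linarith

/-! ### The `L^p` estimate of the kernels -/

/-- The projection onto the model space maps `L^∞` boundedly into `L^p` when `p` is a power of
two. -/
theorem exists_eLpNorm_starProjection_le (hΘ : IsInner Θ) (k : ℕ) : ∃ C : ℝ, 0 ≤ C ∧
    ∀ X : CircleL2, MemLp X ∞ 𝕞 → eLpNorm ((modelSpace Θ).starProjection X) (2 ^ (k + 1)) 𝕞 ≤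
      ENNReal.ofReal C * eLpNorm X ∞ 𝕞 := by
  obtain ⟨C, hC0, hC⟩ := exists_riesz_bound k
  refine ⟨2 * C, by positivity, fun X hX => ?_⟩
  set p : ℝ≥0∞ := 2 ^ (k + 1)
  have hp : 1 ≤ p := one_le_two_pow_ennreal _
  have hm : MemLp (fun t => conj (radialLimit Θ t) * X t) 2 𝕞 :=
    memLp_bdd_mul (memLp_conj hΘ.memLp_radialLimit) (Lp.memLp X)
  have hYX : ∀ᵐ t ∂𝕞, ‖(hm.toLp _ : CircleL2) t‖ = ‖X t‖ := by
    filter_upwards [hm.coeFn_toLp, hΘ.ae_radialLimit] with t h1 h2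
    rw [h1, norm_mul, RCLike.norm_conj, h2.1, one_mul]
  have hXp : MemLp X p 𝕞 := hX.mono_exponent le_top
  have hYp : MemLp (hm.toLp _ : CircleL2) p 𝕞 :=
    hXp.congr_norm (Lp.aestronglyMeasurable _) (hYX.mono fun _ h => h.symm)
  have hXtop : eLpNorm X p 𝕞 ≤ eLpNorm X ∞ 𝕞 :=
    eLpNorm_le_eLpNorm_of_exponent_le le_top hX.1
  have h1 : eLpNorm (rieszProjection X) p 𝕞 ≤ ENNReal.ofReal C * eLpNorm X ∞ 𝕞 :=
    (hC X hXp).trans (by gcongr)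
  have h2 : eLpNorm (fun t => radialLimit Θ t * rieszProjection (hm.toLp _) t) p 𝕞 ≤
      ENNReal.ofReal C * eLpNorm X ∞ 𝕞 := by
    have e : eLpNorm (fun t => radialLimit Θ t * rieszProjection (hm.toLp _) t) p 𝕞 =
        eLpNorm (rieszProjection (hm.toLp _)) p 𝕞 := by
      refine eLpNorm_congr_norm_ae ?_
      filter_upwards [hΘ.ae_radialLimit] with t ht
      rw [norm_mul, ht.1, one_mul]
    rw [e]
    refine (hC _ hYp).trans ?_
    rw [eLpNorm_congr_norm_ae hYX]
    gcongr
  rw [eLpNorm_congr_ae (hΘ.starProjection_modelSpace X _ hm.coeFn_toLp)]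
  refine (eLpNorm_sub_le (Lp.aestronglyMeasurable _)
    (hΘ.memLp_radialLimit.1.mul (Lp.aestronglyMeasurable _)) hp).trans ((add_le_add h1 h2).trans ?_)
  rw [ENNReal.ofReal_mul two_pos.le, ENNReal.ofReal_ofNat, two_mul, add_mul]

/-- If every bounded truncated Toeplitz operator has a bounded symbol, then the `L^p` norms of the
reproducing kernels are dominated by the squares of their `L²` norms, `p` a power of two. -/
theorem exists_eLpNorm_boundaryKernel_le (hΘ : IsInner Θ)
    (hconst : ¬ ∃ c : ℂ, ∀ z ∈ Metric.ball (0 : ℂ) 1, Θ z = c)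
    (hsymb : ∀ A ∈ boundedTruncatedToeplitz Θ, HasBoundedSymbol Θ A) (k : ℕ) :
    ∃ D : ℝ, ∀ l (hl : ‖l‖ < 1), 0 < ‖hΘ.kernelElement hl‖ ∧
      eLpNorm (boundaryKernel Θ l) (2 ^ (k + 1)) 𝕞 ≤
        ENNReal.ofReal (D * ‖hΘ.kernelElement hl‖ ^ 2) := by
  obtain ⟨C₁, hC₁, hproj⟩ := hΘ.exists_eLpNorm_starProjection_le k
  obtain ⟨C₂, hC₂, hbdd⟩ := exists_boundedSymbol_norm_le hsymb
  have h0 : ‖(0 : ℂ)‖ < 1 := by simp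
  have hδ : 0 < 1 - ‖Θ 0‖ := sub_pos.2 (hΘ.norm_zero_lt_one hconst)
  set δ := 1 - ‖Θ 0‖
  set N₀ := ‖hΘ.kernelElement h0‖
  -- `δ⁻¹` comes from dividing by `k_0(l)`, `C₁` from the projection, `2` from `|k_0| ≤ 2`, `C₂`
  -- from the open mapping theorem, and the last factor from `hmax`.
  refine ⟨δ⁻¹ * (C₁ * (2 * (C₂ * (1 + 2 * N₀ / δ)))), fun l hl => ?_⟩
  set N := ‖hΘ.kernelElement hl‖ with hN
  have hlow := hΘ.le_norm_inner_kernelElement_zero hl h0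
  have hNN : δ ≤ N * N₀ := hlow.trans
    (norm_inner_le_norm (𝕜 := ℂ) (hΘ.kernelElement hl) (hΘ.kernelElement h0))
  have hN₀ : 0 ≤ N₀ := norm_nonneg _
  have hNpos : 0 < N := by
    by_contra! h
    nlinarith
  refine ⟨hNpos, ?_⟩
  obtain ⟨ψ, hψ, hψn⟩ := hbdd _ _ (hΘ.isSymbol_rankOneSymbol hl)
  have hmax : max ‖hΘ.rankOneOperator hl‖
      ‖(((hΘ.memLp_rankOneSymbol hl).mono_exponent le_top).toLp _ : CircleL2)‖ ≤
      (1 + 2 * N₀ / δ) * N ^ 2 := by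
    -- By `δ ≤ N N₀`, the linear term `2 N` from the `L²` norm of the symbol is absorbed into `N²`.
    have h1 : N ≤ N₀ / δ * N ^ 2 := by
      rw [div_mul_eq_mul_div, le_div_iff₀ hδ]
      nlinarith
    have h2 : 0 ≤ N₀ / δ := by positivity
    have h3 : 2 * N₀ / δ = 2 * (N₀ / δ) := by ring
    rw [h3]
    refine max_le ((hΘ.norm_rankOneOperator_le hl).trans ?_)
      ((hΘ.norm_toLp_rankOneSymbol_le hl).trans ?_)
    · nlinarith [sq_nonneg N]
    · nlinarith [sq_nonneg N]
  have hψ2 : eLpNorm ψ ∞ 𝕞 ≤ ENNReal.ofReal (C₂ * ((1 + 2 * N₀ / δ) * N ^ 2)) :=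
    hψn.trans (ENNReal.ofReal_le_ofReal (mul_le_mul_of_nonneg_left hmax hC₂.le))
  have hk0 : MemLp (hΘ.kernelElement h0 : CircleL2) ∞ 𝕞 :=
    (hΘ.memLp_boundaryKernel h0).ae_eq (hΘ.coeFn_kernelElement h0).symm
  let f₀ : boundedPart Θ := ⟨hΘ.kernelElement h0, hk0⟩
  set X : CircleL2 := (memLp_symbol_mul ψ f₀).toLp _ with hX
  have hXn : eLpNorm X ∞ 𝕞 ≤ ENNReal.ofReal 2 * eLpNorm ψ ∞ 𝕞 := by
    refine eLpNorm_le_mul_eLpNorm_of_ae_le_mul ?_ _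
    filter_upwards [(memLp_symbol_mul ψ f₀).coeFn_toLp, hΘ.norm_boundaryKernel_zero_le,
      hΘ.coeFn_kernelElement h0] with t h1 h2 h3
    have h4 : (((f₀ : modelSpace Θ) : CircleL2) t) = boundaryKernel Θ 0 t := h3
    rw [h1, h4, norm_mul, mul_comm]
    exact mul_le_mul_of_nonneg_right h2 (norm_nonneg _)
  have hXb : MemLp X ∞ 𝕞 := ⟨Lp.aestronglyMeasurable _, hXn.trans_lt
    (ENNReal.mul_lt_top ENNReal.ofReal_lt_top (hψ2.trans_lt ENNReal.ofReal_lt_top))⟩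
  -- `A k_0` computed twice: through the bounded symbol `ψ`, and through the rank one formula.
  have hA : (modelSpace Θ).starProjection X =
      (inner ℂ (hΘ.kernelElement hl) (hΘ.kernelElement h0) : ℂ) •
        (hΘ.conjugateKernelElement hl : CircleL2) := by
    have h1 := isSymbol_iff.1 hψ f₀
    have h2 := congrArg (Subtype.val : modelSpace Θ → CircleL2) h1
    rw [rankOneOperator_apply, Submodule.coe_smul] at h2
    rw [h2]
    change _ = (modelSpace Θ).starProjection (mulBoundedPart Θ f₀ ψ)
    rw [mulBoundedPart_apply]
  have hfin : eLpNorm (boundaryKernel Θ l) (2 ^ (k + 1)) 𝕞 ≤ ENNReal.ofReal δ⁻¹ *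
      eLpNorm ((modelSpace Θ).starProjection X) (2 ^ (k + 1)) 𝕞 := by
    refine eLpNorm_le_mul_eLpNorm_of_ae_le_mul ?_ _
    rw [hA]
    filter_upwards [Lp.coeFn_smul (inner ℂ (hΘ.kernelElement hl) (hΘ.kernelElement h0) : ℂ)
      (hΘ.conjugateKernelElement hl : CircleL2), hΘ.coeFn_conjugateKernelElement hl,
      hΘ.norm_boundaryKernel_eq l] with t h1 h2 h3
    rw [h1, Pi.smul_apply, h2, norm_smul, h3, inv_mul_eq_div, le_div_iff₀ hδ, mul_comm]
    exact mul_le_mul_of_nonneg_right hlow (norm_nonneg _)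
  refine hfin.trans ?_
  have e : δ⁻¹ * (C₁ * (2 * (C₂ * (1 + 2 * N₀ / δ)))) * N ^ 2 =
      δ⁻¹ * (C₁ * (2 * (C₂ * ((1 + 2 * N₀ / δ) * N ^ 2)))) := by ring
  rw [e, ENNReal.ofReal_mul (by positivity), ENNReal.ofReal_mul hC₁,
    ENNReal.ofReal_mul two_pos.le]
  gcongr
  refine (hproj X hXb).trans ?_
  gcongr
  refine hXn.trans ?_
  gcongr

theorem modelKernelNorm_eq (hΘ : IsInner Θ) {l : ℂ} (hl : ‖l‖ < 1) (p : ℝ≥0∞) :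
    modelKernelNorm Θ p l = eLpNorm (boundaryKernel Θ l) p 𝕞 :=
  eLpNorm_congr_ae (hΘ.radialLimit_modelKernel hl)

theorem modelKernelNorm_two (hΘ : IsInner Θ) {l : ℂ} (hl : ‖l‖ < 1) :
    modelKernelNorm Θ 2 l = ENNReal.ofReal ‖hΘ.kernelElement hl‖ := by
  rw [hΘ.modelKernelNorm_eq hl, Submodule.coe_norm, Lp.norm_def,
    ENNReal.ofReal_toReal (Lp.eLpNorm_ne_top _), eLpNorm_congr_ae (hΘ.coeFn_kernelElement hl)]

end IsInner

end

theorem mainTheorem2 (Θ : ℂ → ℂ) (hΘ : IsInner Θ)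
    (hconst : ¬ ∃ c : ℂ, ∀ z ∈ Metric.ball (0 : ℂ) 1, Θ z = c)
    (hsymb : ∀ A ∈ boundedTruncatedToeplitz Θ, HasBoundedSymbol Θ A)
    (p : ℝ) (hp : 2 < p) :
    (⨆ l ∈ Metric.ball (0 : ℂ) 1,
      modelKernelNorm Θ (ENNReal.ofReal p) l / modelKernelNorm Θ 2 l ^ 2) < ⊤ := by
  -- Any power of two above `p` will do, since `L^p` norms increase with the exponent on a
  -- probability space.
  obtain ⟨k, hk⟩ := pow_unbounded_of_one_lt p one_lt_two
  obtain ⟨D, hD⟩ := hΘ.exists_eLpNorm_boundaryKernel_le hconst hsymb k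
  have hpk : ENNReal.ofReal p ≤ 2 ^ (k + 1) := by
    refine ENNReal.ofReal_le_of_le_toReal ?_
    rw [ENNReal.toReal_pow, ENNReal.toReal_ofNat, pow_succ]
    linarith
  refine lt_of_le_of_lt (iSup₂_le fun l hl => ?_) (ENNReal.ofReal_lt_top (r := D))
  have hl1 : ‖l‖ < 1 := mem_ball_zero_iff.1 hl
  obtain ⟨hpos, hb⟩ := hD l hl1
  rw [hΘ.modelKernelNorm_two hl1, hΘ.modelKernelNorm_eq hl1]
  refine ENNReal.div_le_of_le_mul ?_
  rw [← ENNReal.ofReal_pow hpos.le, ← ENNReal.ofReal_mul' (sq_nonneg _)]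
  exact (eLpNorm_le_eLpNorm_of_exponent_le hpk (hΘ.memLp_boundaryKernel hl1).1).trans hb
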